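/- Let $Q,N>0$ and $P\ge 0$. Let $X_0\sim\mathcal N(0,Q)$, $X_1=X_0+U_1$ and $Y_1=X_1+Z_1$ with $Z_1\sim\mathcal N(0,N)$ independent of everything generated before it; $\mathcal P_{X_1,Y_1|X_0,U_1}$ denotes the corresponding conditional law. Mutual information is the Kullback--Leibler divergence $I(X;Y)=D(\mathcal P_{X,Y}\,\|\,\mathcal P_X\mathcal P_Y)\in[0,\infty]$, and $I(X;Y|Z)=D(\mathcal P_{X,Y,Z}\,\|\,\mathcal P_Z\mathcal P_{X|Z}\mathcal P_{Y|Z})\in[0,\infty]$. Random variables are real-valued; jointly Gaussian families may be degenerate and non-centered. A constraint $I-I'\ge 0$ means $I'\le I$. Without feedback (causal encoder, non-causal decoder): let $\mathbb P(P)$ be the set of tuples $(\mathcal P_{W_1},\mathcal P_{W_2|X_0,W_1},\mathcal P_{U_1|X_0,W_1},\mathcal P_{U_2|W_1,W_2,Y_1})$ such that, under the joint law $$\mathcal P_{X_0}\mathcal P_{W_1}\mathcal P_{W_2|X_0,W_1}\mathcal P_{U_1|X_0,W_1}\mathcal P_{X_1,Y_1|X_0,U_1}\mathcal P_{U_2|W_1,W_2,Y_1},$$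 the variables $X_0,W_1,W_2,U_1,X_1,Y_1,U_2$ are jointly Gaussian, $\mathbb E[U_1^2]=P$ and $I(W_1,W_2;Y_1)-I(W_2;X_0|W_1)\ge 0$. The optimal Gaussian cost is $S_{\mathsf G}(P)=\inf_{\mathbb P(P)}\mathbb E[(X_1-U_2)^2]$. With channel feedback ($Y_1$ is also available to the first decision-maker) the information constraint is replaced by $$I(W_1;Y_1)-I(U_2;X_0|W_1,Y_1)\ge 0.$$ Let $S_{\mathsf G}^{\mathrm{fb}}(P)$ be the infimum of $\mathbb E[(X_1-U_2)^2]$ over the tuples defined as for $\mathbb P(P)$, but with this constraint in place of the one above. Let $\tilde S_{\mathsf G}^{\mathrm{fb}}(P)$ be the infimum of the same cost over the tuples $(\mathcal P_{W_1},\mathcal P_{U_1|X_0,W_1},\mathcal P_{U_2|X_0,W_1,Y_1})$ such that, under the joint law $\mathcal P_{X_0}\mathcal P_{W_1}\mathcal P_{U_1|X_0,W_1}\mathcal P_{X_1,Y_1|X_0,U_1}\mathcal P_{U_2|X_0,W_1,Y_1}$ (no $W_2$), the variables $X_0,W_1,U_1,X_1,Y_1,U_2$ are jointly Gaussian, $\mathbb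 E[U_1^2]=P$, and the feedback information constraint holds. Then all three optimization domains are non-empty, and $$S_{\mathsf G}^{\mathrm{fb}}(P)=\tilde S_{\mathsf G}^{\mathrm{fb}}(P)=S_{\mathsf G}(P)=\begin{cases}\dfrac{N(Q-N-P)}{Q}&\text{if }Q>4N\text{ and }P\in[P_1,P_2],\\[2mm] S_\ell(P)&\text{otherwise,}\end{cases}$$ where $P_{1}=\tfrac12\bigl(Q-2N-\sqrt{Q^2-4QN}\bigr)$, $P_{2}=\tfrac12\bigl(Q-2N+\sqrt{Q^2-4QN}\bigr)$, and $$S_\ell(P)=\begin{cases}\dfrac{(\sqrt Q-\sqrt P)^2N}{(\sqrt Q-\sqrt P)^2+N}&\text{if }P\in[0,Q],\\ 0&\text{otherwise.}\end{cases}$$ Hence channel feedback gives no gain in the Gaussian case. -/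

import Mathlib

open MeasureTheory ProbabilityTheory
open scoped ENNReal NNReal

namespace Witsenhausen

noncomputable section

/-- Mutual information `I(X; Y)` under `μ` (in nats, with values in `[0, ∞]`): the Kullback-Leibler
divergence between the joint law of `(X, Y)` and the product of the marginal laws. -/
def mutualInfo {Ω α β : Type*} [MeasurableSpace Ω] [MeasurableSpace α] [MeasurableSpace β]
    (μ : Measure Ω) (X : Ω → α) (Y : Ω → β) : ℝ≥0∞ :=
  InformationTheory.klDiv (μ.map fun ω => (X ω, Y ω)) ((μ.map X).prod (μ.map Y))

/-- Conditional mutual information `I(X; Y | Z)` under `μ` (in nats, with values in `[0, ∞]`): the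
Kullback-Leibler divergence between the joint law `P_{Z, X, Y}` and `P_Z P_{X | Z} P_{Y | Z}`. -/
def condMutualInfo {Ω α β γ : Type*} [MeasurableSpace Ω]
    [MeasurableSpace α] [StandardBorelSpace α] [Nonempty α]
    [MeasurableSpace β] [StandardBorelSpace β] [Nonempty β] [MeasurableSpace γ]
    (μ : Measure Ω) [IsFiniteMeasure μ] (X : Ω → α) (Y : Ω → β) (Z : Ω → γ) : ℝ≥0∞ :=
  InformationTheory.klDiv (μ.map fun ω => (Z ω, (X ω, Y ω)))
    ((μ.map Z).compProd ((condDistrib X Z μ).prod (condDistrib Y Z μ)))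

/-- The kernel `P_{X₁, Y₁ | X₀, U₁}`: given `(x₀, u₁)`, the law of `(x₀ + u₁, x₀ + u₁ + Z₁)` with
`Z₁ ∼ 𝒩(0, N)`. -/
def channel (N : ℝ≥0) : Kernel (ℝ × ℝ) (ℝ × ℝ) :=
  (Kernel.id.prod (Kernel.const (ℝ × ℝ) (gaussianReal 0 N))).map
    fun p => (p.1.1 + p.1.2, p.1.1 + p.1.2 + p.2)

instance (N : ℝ≥0) : IsMarkovKernel (channel N) :=
  Kernel.IsMarkovKernel.map _ (by fun_prop)

/-! ### Designs with the two auxiliary random variables `W₁, W₂` -/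

/-- A tuple `(P_{W₁}, P_{W₂ | X₀, W₁}, P_{U₁ | X₀, W₁}, P_{U₂ | W₁, W₂, Y₁})`. -/
structure Design where
  lawW1 : Measure ℝ
  kerW2 : Kernel (ℝ × ℝ) ℝ
  kerU1 : Kernel (ℝ × ℝ) ℝ
  kerU2 : Kernel (ℝ × ℝ × ℝ) ℝ
  [probW1 : IsProbabilityMeasure lawW1]
  [markovW2 : IsMarkovKernel kerW2]
  [markovU1 : IsMarkovKernel kerU1]
  [markovU2 : IsMarkovKernel kerU2]

attribute [instance] Design.probW1 Design.markovW2 Design.markovU1 Design.markovU2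

/-- The space of outcomes `((((x₀, w₁), (w₂, u₁)), (x₁, y₁)), u₂)`. -/
abbrev Outcome : Type := (((ℝ × ℝ) × (ℝ × ℝ)) × (ℝ × ℝ)) × ℝ

def X0 (ω : Outcome) : ℝ := ω.1.1.1.1
def W1 (ω : Outcome) : ℝ := ω.1.1.1.2
def W2 (ω : Outcome) : ℝ := ω.1.1.2.1
def U1 (ω : Outcome) : ℝ := ω.1.1.2.2
def X1 (ω : Outcome) : ℝ := ω.1.2.1
def Y1 (ω : Outcome) : ℝ := ω.1.2.2
def U2 (ω : Outcome) : ℝ := ω.2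

/-- The joint law
`P_{X₀} P_{W₁} P_{W₂ | X₀, W₁} P_{U₁ | X₀, W₁} P_{X₁, Y₁ | X₀, U₁} P_{U₂ | W₁, W₂, Y₁}`
with `P_{X₀} = 𝒩(0, Q)`. -/
def Design.law (Q N : ℝ≥0) (d : Design) : Measure Outcome :=
  ((((gaussianReal 0 Q).prod d.lawW1).compProd (d.kerW2.prod d.kerU1)).compProd
      ((channel N).comap (fun p => (p.1.1, p.2.2)) (by fun_prop))).compProd
    (d.kerU2.comap (fun p => (p.1.1.2, p.1.2.1, p.2.2)) (by fun_prop))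

instance (Q N : ℝ≥0) (d : Design) : IsProbabilityMeasure (d.law Q N) := by
  unfold Design.law; infer_instance

/-- The optimization domain without feedback: `E[U₁²] = P`, all variables are jointly Gaussian, and
`I(W₁, W₂; Y₁) - I(W₂; X₀ | W₁) ≥ 0`. -/
def domain (Q N : ℝ≥0) (P : ℝ) : Set Design :=
  {d | IsGaussian (d.law Q N) ∧ ∫ ω, U1 ω ^ 2 ∂(d.law Q N) = P ∧
    condMutualInfo (d.law Q N) W2 X0 W1 ≤
      mutualInfo (d.law Q N) (fun ω => (W1 ω, W2 ω)) Y1}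

/-- The same optimization domain for the problem with channel feedback, where the information
constraint is `I(W₁; Y₁) - I(U₂; X₀ | W₁, Y₁) ≥ 0`. -/
def feedbackDomain (Q N : ℝ≥0) (P : ℝ) : Set Design :=
  {d | IsGaussian (d.law Q N) ∧ ∫ ω, U1 ω ^ 2 ∂(d.law Q N) = P ∧
    condMutualInfo (d.law Q N) U2 X0 (fun ω => (W1 ω, Y1 ω)) ≤
      mutualInfo (d.law Q N) W1 Y1}

/-- The estimation cost `E[(X₁ - U₂)²]`. -/
def Design.cost (Q N : ℝ≥0) (d : Design) : ℝ :=
  ∫ ω, (X1 ω - U2 ω) ^ 2 ∂(d.law Q N)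

/-- The optimal Gaussian cost without feedback. -/
def gaussianCost (Q N : ℝ≥0) (P : ℝ) : ℝ :=
  sInf (Design.cost Q N '' domain Q N P)

/-- The optimal Gaussian cost with channel feedback. -/
def feedbackGaussianCost (Q N : ℝ≥0) (P : ℝ) : ℝ :=
  sInf (Design.cost Q N '' feedbackDomain Q N P)

/-! ### Feedback designs in which `U₂` is generated directly from `(X₀, W₁, Y₁)` -/

/-- A tuple `(P_{W₁}, P_{U₁ | X₀, W₁}, P_{U₂ | X₀, W₁, Y₁})`. -/
structure DirectDesign where
  lawW1 : Measure ℝ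
  kerU1 : Kernel (ℝ × ℝ) ℝ
  kerU2 : Kernel (ℝ × ℝ × ℝ) ℝ
  [probW1 : IsProbabilityMeasure lawW1]
  [markovU1 : IsMarkovKernel kerU1]
  [markovU2 : IsMarkovKernel kerU2]

attribute [instance] DirectDesign.probW1 DirectDesign.markovU1 DirectDesign.markovU2

namespace DirectDesign

/-- The space of outcomes `((((x₀, w₁), u₁), (x₁, y₁)), u₂)`. -/
abbrev Outcome : Type := (((ℝ × ℝ) × ℝ) × (ℝ × ℝ)) × ℝ

def X0 (ω : DirectDesign.Outcome) : ℝ := ω.1.1.1.1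
def W1 (ω : DirectDesign.Outcome) : ℝ := ω.1.1.1.2
def U1 (ω : DirectDesign.Outcome) : ℝ := ω.1.1.2
def X1 (ω : DirectDesign.Outcome) : ℝ := ω.1.2.1
def Y1 (ω : DirectDesign.Outcome) : ℝ := ω.1.2.2
def U2 (ω : DirectDesign.Outcome) : ℝ := ω.2

/-- The joint law `P_{X₀} P_{W₁} P_{U₁ | X₀, W₁} P_{X₁, Y₁ | X₀, U₁} P_{U₂ | X₀, W₁, Y₁}` with
`P_{X₀} = 𝒩(0, Q)`. -/
def law (Q N : ℝ≥0) (d : DirectDesign) : Measure DirectDesign.Outcome :=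
  ((((gaussianReal 0 Q).prod d.lawW1).compProd d.kerU1).compProd
      ((channel N).comap (fun p => (p.1.1, p.2)) (by fun_prop))).compProd
    (d.kerU2.comap (fun p => (p.1.1.1, p.1.1.2, p.2.2)) (by fun_prop))

instance (Q N : ℝ≥0) (d : DirectDesign) : IsProbabilityMeasure (d.law Q N) := by
  unfold DirectDesign.law; infer_instance

/-- `E[U₁²] = P`, all variables are jointly Gaussian, and `I(W₁; Y₁) - I(U₂; X₀ | W₁, Y₁) ≥ 0`. -/
def domain (Q N : ℝ≥0) (P : ℝ) : Set DirectDesign :=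
  {d | IsGaussian (d.law Q N) ∧ ∫ ω, U1 ω ^ 2 ∂(d.law Q N) = P ∧
    condMutualInfo (d.law Q N) U2 X0 (fun ω => (W1 ω, Y1 ω)) ≤
      mutualInfo (d.law Q N) W1 Y1}

/-- The estimation cost `E[(X₁ - U₂)²]`. -/
def cost (Q N : ℝ≥0) (d : DirectDesign) : ℝ :=
  ∫ ω, (X1 ω - U2 ω) ^ 2 ∂(d.law Q N)

end DirectDesign

/-- The optimal Gaussian cost with channel feedback, over the direct designs. -/
def directFeedbackGaussianCost (Q N : ℝ≥0) (P : ℝ) : ℝ :=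
  sInf (DirectDesign.cost Q N '' DirectDesign.domain Q N P)

/-! ### The closed formula -/

/-- The best linear cost `S_ℓ(P)`. -/
def linearCost (Q N P : ℝ) : ℝ :=
  if P ≤ Q then (√Q - √P) ^ 2 * N / ((√Q - √P) ^ 2 + N) else 0

def powerOne (Q N : ℝ) : ℝ := (Q - 2 * N - √(Q ^ 2 - 4 * Q * N)) / 2

def powerTwo (Q N : ℝ) : ℝ := (Q - 2 * N + √(Q ^ 2 - 4 * Q * N)) / 2

open Classical in
/-- `N (Q - N - P) / Q` if `Q > 4 N` and `P ∈ [P₁, P₂]`, and `S_ℓ(P)` otherwise. -/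
def optimalCost (Q N P : ℝ) : ℝ :=
  if 4 * N < Q ∧ P ∈ Set.Icc (powerOne Q N) (powerTwo Q N) then N * (Q - N - P) / Q
  else linearCost Q N P

end

end Witsenhausen

/-! For jointly Gaussian variables, independence and information are read off the covariance form on
linear functionals, so the problem becomes the geometry of a positive semidefinite form. Write U₁ =
a X₀ + b W₁ + V with V uncorrelated with X₀ and W₁, let Z be the channel noise, and put v = Var V, β
= b² Var W₁, D = Var Y₁ = (1+a)²Q + β + v + N.

Converse. Each information is half the logarithm of a ratio of residual variances. With or without
feedback, the constraint reduces to the same inequality r ≥ Q(v+N)/D, where r is the residual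
variance of X₀ given (W₁, Y₁, U₂), respectively (W₁, W₂, Y₁). This coincidence is why feedback gains
nothing. The error X₁ − U₂ has known components along two orthogonal vectors: that residual, and N V
− v Z, the part of V that the output hides. Bessel's inequality (`estimation_error_ge`) bounds the
error below by vN/(v+N) + ((1+a)N/(v+N))² r, which by `schemeCost_le_error` is at least NC/(C+β+N)
with C = (1+a)²Q + v. Setting s² = a²Q + v, one has C ≥ (√Q−s)² and, by the power constraint, β ≤ P
− s². What remains is a minimisation over s ∈ [0, √P] (`optimalCost_le_of_sqrt`): the stationary
point s = (P+N)/√Q is admissible exactly when (P+N)² ≤ PQ, that is P ∈ [P₁, P₂]; otherwise the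
minimum is at s = min(√P, √Q). Means only increase power and cost, so working with variances loses
nothing. The bounds are assembled in `IsChannelModel.optimalCost_le_of_feedback` and
`IsChannelModel.optimalCost_le_of_auxiliary`.

Achievability. Take V = 0, W₁ ∼ 𝒩(0, 1), W₂ = b X₀ + T with an independent T ∼ 𝒩(0, NQ), and let U₂
be the best linear estimate of X₁ from (W₁, W₂, Y₁). This one scheme satisfies all three sets of
constraints, and `exists_scheme_cost_eq` chooses a and b. -/

namespace Witsenhausen

/-! ### Divergence between Gaussian kernels. -/

section Divergence

variable {Ω α β γ : Type*} [MeasurableSpace Ω] [MeasurableSpace α] [MeasurableSpace β]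
  [MeasurableSpace γ]

/-- The kernel `a ↦ 𝒩(m a, v)`. -/
noncomputable def gaussianKernel (m : α → ℝ) (hm : Measurable m) (v : ℝ≥0) : Kernel α ℝ where
  toFun a := gaussianReal (m a) v
  measurable' := by
    have := measurable_gaussianReal
    exact this.comp (hm.prodMk measurable_const)

instance (m : α → ℝ) (hm : Measurable m) (v : ℝ≥0) :
    IsMarkovKernel (gaussianKernel m hm v) :=
  ⟨fun a => inferInstanceAs (IsProbabilityMeasure (gaussianReal (m a) v))⟩

lemma gaussianKernel_apply (m : α → ℝ) (hm : Measurable m) (v : ℝ≥0) (a : α) :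
    gaussianKernel m hm v a = gaussianReal (m a) v := rfl

lemma prod_gaussianReal_map (ρ : Measure α) [IsProbabilityMeasure ρ] (m : α → ℝ)
    (hm : Measurable m) (v : ℝ≥0) :
    (ρ.prod (gaussianReal 0 v)).map (fun p => (p.1, m p.1 + p.2)) =
      ρ.compProd (gaussianKernel m hm v) := by
  refine Measure.ext_of_lintegral _ fun f hf => ?_
  rw [lintegral_map hf (by fun_prop), Measure.lintegral_compProd hf,
    lintegral_prod _ (by fun_prop)]
  refine lintegral_congr fun a => ?_
  have := gaussianReal_map_const_add (μ := 0) (v := v) (m a)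
  rw [gaussianKernel_apply, ← zero_add (m a), ← this, lintegral_map (by fun_prop) (by fun_prop)]

/-- A residual independent of G turns the regression of Y on G into a genuine conditional law: a
Gaussian of fixed variance centred at the regression function. -/
lemma map_prodMk_eq_compProd_gaussianKernel (μ : Measure Ω) [IsProbabilityMeasure μ]
    {G : Ω → α} {Y : Ω → ℝ} (hG : Measurable G) (hY : Measurable Y) {m : α → ℝ}
    (hm : Measurable m) {v : ℝ≥0} (hind : IndepFun G (fun ω => Y ω - m (G ω)) μ)
    (hlaw : μ.map (fun ω => Y ω - m (G ω)) = gaussianReal 0 v) :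
    μ.map (fun ω => (G ω, Y ω)) = (μ.map G).compProd (gaussianKernel m hm v) := by
  have : IsProbabilityMeasure (μ.map G) := Measure.isProbabilityMeasure_map hG.aemeasurable
  rw [← prod_gaussianReal_map, ← hlaw,
    ← (indepFun_iff_map_prod_eq_prod_map_map hG.aemeasurable (by fun_prop)).1 hind,
    Measure.map_map (by fun_prop) (by fun_prop)]
  congr 1
  ext ω <;> simp

lemma integral_sq_of_map_eq_gaussianReal {μ : Measure Ω} {R : Ω → ℝ} (hR : Measurable R)
    {v : ℝ≥0} (h : μ.map R = gaussianReal 0 v) :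
    Integrable (fun ω => R ω ^ 2) μ ∧ ∫ ω, R ω ^ 2 ∂μ = v := by
  have h2 : MemLp id 2 (gaussianReal 0 v) := memLp_id_gaussianReal 2
  constructor
  · have := h2.integrable_sq
    rw [← h, integrable_map_measure (by fun_prop) (by fun_prop)] at this
    exact this
  · have h3 := variance_fun_id_gaussianReal (μ := 0) (v := v)
    rw [variance_of_integral_eq_zero (by fun_prop) (by simp), ← h,
      integral_map (by fun_prop) (by fun_prop)] at h3
    exact h3

/-- The density of `𝒩(m a, r)` with respect to `𝒩(m' a, s)`. -/
noncomputable def gaussianRatio (m m' : α → ℝ) (r s : ℝ≥0) (p : α × ℝ) : ℝ :=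
  √(s / r) * Real.exp ((p.2 - m' p.1) ^ 2 / (2 * s) - (p.2 - m p.1) ^ 2 / (2 * r))

lemma measurable_gaussianRatio {m m' : α → ℝ} (hm : Measurable m) (hm' : Measurable m')
    (r s : ℝ≥0) : Measurable (gaussianRatio m m' r s) := by
  unfold gaussianRatio; fun_prop

lemma gaussianReal_eq_withDensity_gaussianRatio (m m' : α → ℝ) {r s : ℝ≥0} (hr : r ≠ 0)
    (hs : s ≠ 0) (hm : Measurable m) (hm' : Measurable m') (a : α) :
    gaussianReal (m a) r = (gaussianReal (m' a) s).withDensity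
      (fun y => ENNReal.ofReal (gaussianRatio m m' r s (a, y))) := by
  have hmeas : Measurable (fun y => ENNReal.ofReal (gaussianRatio m m' r s (a, y))) :=
    ((measurable_gaussianRatio hm hm' r s).comp (by fun_prop)).ennreal_ofReal
  rw [gaussianReal_of_var_ne_zero _ hr, gaussianReal_of_var_ne_zero _ hs,
    ← withDensity_mul _ (measurable_gaussianPDF _ _) hmeas]
  congr 1
  ext y
  simp only [Pi.mul_apply, gaussianPDF]
  rw [← ENNReal.ofReal_mul (gaussianPDFReal_nonneg _ _ _)]
  congr 1
  simp only [gaussianPDFReal, gaussianRatio]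
  have h1 : (0 : ℝ) < r := by positivity
  have h2 : (0 : ℝ) < s := by positivity
  have h3 : √(s / r : ℝ) = √(2 * Real.pi * s) / √(2 * Real.pi * r) := by
    rw [← Real.sqrt_div (by positivity)]
    congr 1
    field_simp
  have h4 : 0 < √(2 * Real.pi * s) := by positivity
  have h5 : 0 < √(2 * Real.pi * r) := by positivity
  rw [h3, Real.exp_sub, neg_div, neg_div, Real.exp_neg, Real.exp_neg]
  field_simp

lemma compProd_gaussianKernel_eq_withDensity (ρ : Measure α) [IsProbabilityMeasure ρ]
    {m m' : α → ℝ} {r s : ℝ≥0} (hr : r ≠ 0) (hs : s ≠ 0) (hm : Measurable m)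
    (hm' : Measurable m') :
    ρ.compProd (gaussianKernel m hm r) = (ρ.compProd (gaussianKernel m' hm' s)).withDensity
      (fun p => ENNReal.ofReal (gaussianRatio m m' r s p)) := by
  have hmeas := (measurable_gaussianRatio hm hm' r s).ennreal_ofReal
  refine Measure.ext_of_lintegral _ fun f hf => ?_
  rw [lintegral_withDensity_eq_lintegral_mul _ hmeas hf, Measure.lintegral_compProd hf,
    Measure.lintegral_compProd (by fun_prop)]
  refine lintegral_congr fun a => ?_
  rw [gaussianKernel_apply, gaussianKernel_apply,
    gaussianReal_eq_withDensity_gaussianRatio m m' hr hs hm hm' a,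
    lintegral_withDensity_eq_lintegral_mul _
      (f := fun y => ENNReal.ofReal (gaussianRatio m m' r s (a, y)))
      (hmeas.comp (by fun_prop)) (by fun_prop)]
  rfl

/-- If `Y = m(G) + R` with `R ∼ 𝒩(0, r)` independent of `G`, and `Y - m'(G) ∼ 𝒩(0, s)`, then the
divergence between the law of `(G, Y)` and `P_G ⊗ 𝒩(m'(·), s)` is `log (s / r) / 2`. -/
lemma klDiv_map_prodMk_gaussianKernel (μ : Measure Ω) [IsProbabilityMeasure μ]
    {G : Ω → α} {Y : Ω → ℝ} (hG : Measurable G) (hY : Measurable Y) {m m' : α → ℝ}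
    (hm : Measurable m) (hm' : Measurable m') {r s : ℝ≥0} (hr : r ≠ 0) (hs : s ≠ 0)
    (hind : IndepFun G (fun ω => Y ω - m (G ω)) μ)
    (hR : μ.map (fun ω => Y ω - m (G ω)) = gaussianReal 0 r)
    (hS : μ.map (fun ω => Y ω - m' (G ω)) = gaussianReal 0 s) :
    InformationTheory.klDiv (μ.map fun ω => (G ω, Y ω))
      ((μ.map G).compProd (gaussianKernel m' hm' s)) =
      ENNReal.ofReal (Real.log (s / r) / 2) := by
  have : IsProbabilityMeasure (μ.map G) := Measure.isProbabilityMeasure_map hG.aemeasurable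
  have : IsProbabilityMeasure (μ.map fun ω => (G ω, Y ω)) :=
    Measure.isProbabilityMeasure_map (by fun_prop)
  have h1 : (0 : ℝ) < r := by positivity
  have h2 : (0 : ℝ) < s := by positivity
  have hmeas := measurable_gaussianRatio hm hm' r s
  have hdens := map_prodMk_eq_compProd_gaussianKernel μ hG hY hm hind hR
  rw [compProd_gaussianKernel_eq_withDensity (μ.map G) hr hs hm hm'] at hdens
  have hac : μ.map (fun ω => (G ω, Y ω)) ≪ (μ.map G).compProd (gaussianKernel m' hm' s) := by
    rw [hdens]; exact withDensity_absolutelyContinuous _ _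
  have hllr : llr (μ.map fun ω => (G ω, Y ω)) ((μ.map G).compProd (gaussianKernel m' hm' s))
      =ᵐ[μ.map fun ω => (G ω, Y ω)] fun p => Real.log (s / r) / 2 +
        ((p.2 - m' p.1) ^ 2 / (2 * s) - (p.2 - m p.1) ^ 2 / (2 * r)) := by
    have := Measure.rnDeriv_withDensity ((μ.map G).compProd (gaussianKernel m' hm' s))
      hmeas.ennreal_ofReal
    rw [← hdens] at this
    filter_upwards [hac.ae_le this] with p hp
    have hpos : 0 < √(s / r : ℝ) := by positivity
    rw [llr, hp, ENNReal.toReal_ofReal (by unfold gaussianRatio; positivity), gaussianRatio,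
      Real.log_mul (by positivity) (by positivity), Real.log_exp, Real.log_sqrt (by positivity)]
  obtain ⟨hRi, hRe⟩ := integral_sq_of_map_eq_gaussianReal (by fun_prop) hR
  obtain ⟨hSi, hSe⟩ := integral_sq_of_map_eq_gaussianReal (by fun_prop) hS
  have hint : Integrable (fun p : α × ℝ => Real.log (s / r) / 2 +
        ((p.2 - m' p.1) ^ 2 / (2 * s) - (p.2 - m p.1) ^ 2 / (2 * r)))
        (μ.map fun ω => (G ω, Y ω)) := by
    rw [integrable_map_measure (Measurable.aestronglyMeasurable (by fun_prop)) (by fun_prop)]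
    exact (integrable_const _).add ((hSi.div_const _).sub (hRi.div_const _))
  rw [InformationTheory.klDiv_of_ac_of_integrable hac ((integrable_congr hllr).2 hint),
    integral_congr_ae hllr,
    integral_map (by fun_prop) (Measurable.aestronglyMeasurable (by fun_prop))]
  simp only [probReal_univ, add_sub_cancel_right]
  have hsum := integral_add (μ := μ) (integrable_const (Real.log (s / r) / 2))
    ((hSi.div_const (2 * s)).sub (hRi.div_const (2 * r)))
  simp only [Pi.sub_apply] at hsum
  -- Each quadratic term has expectation 1/2, so the two cancel and only the logarithm survives.
  rw [hsum, integral_sub (hSi.div_const _) (hRi.div_const _), integral_div (2 * (s : ℝ)), integral_div (2 * (r : ℝ)), hRe, hSe]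
  congr 1
  simp
  field_simp
  simp

/-- The joint law lives on the graph of m, which is null for a kernel of positive variance; absolute
continuity fails. -/
lemma klDiv_map_prodMk_gaussianKernel_eq_top (μ : Measure Ω) [IsProbabilityMeasure μ]
    {G : Ω → α} {Y : Ω → ℝ} (hG : Measurable G) (hY : Measurable Y) {m m' : α → ℝ}
    (hm : Measurable m) (hm' : Measurable m') {s : ℝ≥0} (hs : s ≠ 0)
    (hR : ∀ᵐ ω ∂μ, Y ω = m (G ω)) :
    InformationTheory.klDiv (μ.map fun ω => (G ω, Y ω))
      ((μ.map G).compProd (gaussianKernel m' hm' s)) = ∞ := by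
  have : IsProbabilityMeasure (μ.map G) := Measure.isProbabilityMeasure_map hG.aemeasurable
  refine InformationTheory.klDiv_of_not_ac fun hac => ?_
  have hgraph : MeasurableSet {p : α × ℝ | p.2 = m p.1} :=
    measurableSet_eq_fun (by fun_prop) (by fun_prop)
  have hnull : ((μ.map G).compProd (gaussianKernel m' hm' s)) {p : α × ℝ | p.2 = m p.1} = 0 := by
    rw [Measure.compProd_apply hgraph, lintegral_eq_zero_iff'
      (Kernel.measurable_kernel_prodMk_left hgraph).aemeasurable]
    refine Filter.Eventually.of_forall fun a => ?_
    have := nullSingletonClass_gaussianReal (μ := m' a) hs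
    have h : Prod.mk a ⁻¹' {p : α × ℝ | p.2 = m p.1} = {m a} := by ext; simp
    simp only [h, gaussianKernel_apply, measure_singleton, Pi.zero_apply]
  have h0 := hac hnull
  rw [Measure.map_apply (by fun_prop) hgraph] at h0
  have hfalse : ∀ᵐ ω ∂μ, False := by
    filter_upwards [hR, measure_eq_zero_iff_ae_notMem.1 h0] with ω h1 h2 using h2 h1
  exact IsProbabilityMeasure.ne_zero μ (by simpa using hfalse)

/-- Data processing applied to the map and to its inverse. -/
lemma klDiv_map_measurableEquiv (μ ν : Measure α) [IsFiniteMeasure μ] [IsFiniteMeasure ν]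
    (e : α ≃ᵐ β) :
    InformationTheory.klDiv (μ.map e) (ν.map e) = InformationTheory.klDiv μ ν := by
  refine le_antisymm (InformationTheory.klDiv_map_le _ _ e.measurable) ?_
  have := InformationTheory.klDiv_map_le (μ.map e) (ν.map e) e.symm.measurable
  simpa using this

/-- The independent residual identifies P_{Y|Z} as a Gaussian kernel. Reassociating the triple
merges P_Z P_{X|Z} into the law of (Z, X), so conditional information becomes a divergence of the
kind computed above. -/
lemma condMutualInfo_eq_klDiv [StandardBorelSpace α] [Nonempty α]
    (μ : Measure Ω) [IsProbabilityMeasure μ] {X : Ω → α} {Y : Ω → ℝ} {Z : Ω → γ}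
    (hX : Measurable X) (hY : Measurable Y) (hZ : Measurable Z) {m' : γ → ℝ}
    (hm' : Measurable m') {s : ℝ≥0} (hind : IndepFun Z (fun ω => Y ω - m' (Z ω)) μ)
    (hS : μ.map (fun ω => Y ω - m' (Z ω)) = gaussianReal 0 s) :
    condMutualInfo μ X Y Z = InformationTheory.klDiv (μ.map fun ω => ((Z ω, X ω), Y ω))
      ((μ.map fun ω => (Z ω, X ω)).compProd
        (gaussianKernel (fun p => m' p.1) (by fun_prop) s)) := by
  have : IsProbabilityMeasure (μ.map Z) := Measure.isProbabilityMeasure_map hZ.aemeasurable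
  have : IsProbabilityMeasure (μ.map fun ω => ((Z ω, X ω), Y ω)) :=
    Measure.isProbabilityMeasure_map (by fun_prop)
  have : IsProbabilityMeasure (μ.map fun ω => (Z ω, X ω)) :=
    Measure.isProbabilityMeasure_map (by fun_prop)
  have hcd := condDistrib_ae_eq_of_measure_eq_compProd (μ := μ) Z hY.aemeasurable
    (map_prodMk_eq_compProd_gaussianKernel μ hZ hY hm' hind hS)
  rw [← klDiv_map_measurableEquiv _ _ MeasurableEquiv.prodAssoc, condMutualInfo]
  congr 1
  · rw [Measure.map_map (by fun_prop) (by fun_prop)]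
    rfl
  · rw [← compProd_map_condDistrib hX.aemeasurable]
    refine Measure.ext_of_lintegral _ fun f hf => ?_
    rw [lintegral_map hf (by fun_prop), Measure.lintegral_compProd hf,
      Measure.lintegral_compProd (by fun_prop), Measure.lintegral_compProd (by fun_prop)]
    refine lintegral_congr_ae ?_
    filter_upwards [hcd] with z hz
    rw [Kernel.prod_apply, lintegral_prod _ (by fun_prop), hz]
    rfl

end Divergence

/-! ### Checking uncorrelatedness coordinate by coordinate. -/

section Orthogonality

variable {F E E' : Type*} [NormedAddCommGroup F] [NormedSpace ℝ F] [MeasurableSpace F]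
  [BorelSpace F] [NormedAddCommGroup E] [NormedSpace ℝ E] [NormedAddCommGroup E']
  [NormedSpace ℝ E'] {μ : Measure F}

lemma covarianceBilinDual_comp_real (R g : F →L[ℝ] ℝ) (h : covarianceBilinDual μ R g = 0)
    (L : ℝ →L[ℝ] ℝ) : covarianceBilinDual μ R (L.comp g) = 0 := by
  have : L.comp g = L 1 • g := by
    ext ω
    simpa [mul_comm] using L.map_smul (g ω) 1
  rw [this, map_smul, h, smul_zero]

lemma covarianceBilinDual_comp_prod (R : F →L[ℝ] ℝ) (G : F →L[ℝ] E) (G' : F →L[ℝ] E')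
    (h : ∀ L : E →L[ℝ] ℝ, covarianceBilinDual μ R (L.comp G) = 0)
    (h' : ∀ L : E' →L[ℝ] ℝ, covarianceBilinDual μ R (L.comp G') = 0)
    (L : E × E' →L[ℝ] ℝ) : covarianceBilinDual μ R (L.comp (G.prod G')) = 0 := by
  have : L.comp (G.prod G') = (L.comp (.inl ℝ E E')).comp G + (L.comp (.inr ℝ E E')).comp G' := by
    ext ω
    simp only [ContinuousLinearMap.comp_apply, ContinuousLinearMap.prod_apply,
      add_apply, ContinuousLinearMap.inl_apply, ContinuousLinearMap.inr_apply]
    rw [← map_add]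
    simp
  rw [this, map_add, h, h', add_zero]

end Orthogonality

/-! ### Information as a ratio of residual variances. -/

section GaussianDivergence

variable {F E E' : Type*} [NormedAddCommGroup F] [NormedSpace ℝ F] [CompleteSpace F]
  [SecondCountableTopology F] [MeasurableSpace F] [BorelSpace F]
  [NormedAddCommGroup E] [NormedSpace ℝ E] [CompleteSpace E]
  [SecondCountableTopology E] [MeasurableSpace E] [BorelSpace E]
  [NormedAddCommGroup E'] [NormedSpace ℝ E'] [CompleteSpace E']
  [SecondCountableTopology E'] [MeasurableSpace E'] [BorelSpace E']
  {μ : Measure F} [IsGaussian μ]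

lemma covarianceBilinDual_eq_cov (L L' : F →L[ℝ] ℝ) :
    covarianceBilinDual μ L L' = cov[L, L'; μ] :=
  covarianceBilinDual_eq_covariance IsGaussian.memLp_two_id L L'

/-- The bridge from second-order data to probability: under a jointly Gaussian law, possibly
degenerate, uncorrelated linear maps are independent. -/
lemma indepFun_of_covarianceBilinDual_eq_zero (G : F →L[ℝ] E) (R : F →L[ℝ] ℝ)
    (h : ∀ L : E →L[ℝ] ℝ, covarianceBilinDual μ R (L.comp G) = 0) : IndepFun G R μ := by
  have hg : HasGaussianLaw (fun ω => (G ω, R ω)) μ :=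
    IsGaussian.hasGaussianLaw_id.map (G.prod R)
  refine hg.indepFun_of_covariance_strongDual fun L₁ L₂ => ?_
  have h1 : (⇑L₂ ∘ ⇑R) = fun ω => L₂ 1 * R ω := by
    funext ω
    simpa [mul_comm] using L₂.map_smul (R ω) 1
  have h2 := h L₁
  rw [covarianceBilinDual_comm, covarianceBilinDual_eq_cov] at h2
  rw [h1, covariance_const_mul_right]
  simp [h2, show (⇑L₁ ∘ ⇑G) = ⇑(L₁.comp G) from rfl]

lemma map_sub_integral_eq_gaussianReal (R : F →L[ℝ] ℝ) :
    μ.map (fun ω => R ω - ∫ ω', R ω' ∂μ) =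
      gaussianReal 0 (covarianceBilinDual μ R R).toNNReal := by
  have h : μ.map R = gaussianReal (∫ ω, R ω ∂μ) (covarianceBilinDual μ R R).toNNReal := by
    have hg : HasGaussianLaw R μ := IsGaussian.hasGaussianLaw_id.map R
    rw [hg.map_eq_gaussianReal,
      covarianceBilinDual_self_eq_variance IsGaussian.memLp_two_id]
  have h2 : μ.map (fun ω => R ω - ∫ ω', R ω' ∂μ) =
      (μ.map R).map (fun x => x - ∫ ω', R ω' ∂μ) := by
    rw [Measure.map_map (by fun_prop) (by fun_prop)]; rfl
  rw [h2, h, gaussianReal_map_sub_const, sub_self]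

lemma ae_eq_integral_of_covarianceBilinDual_eq_zero (R : F →L[ℝ] ℝ)
    (h : covarianceBilinDual μ R R = 0) : ∀ᵐ ω ∂μ, R ω = ∫ ω', R ω' ∂μ := by
  have hm := map_sub_integral_eq_gaussianReal (μ := μ) R
  rw [h, Real.toNNReal_zero, gaussianReal_zero_var] at hm
  have : ∀ᵐ x ∂(μ.map fun ω => R ω - ∫ ω', R ω' ∂μ), x = 0 := by
    rw [hm, ae_dirac_eq]; simp
  filter_upwards [ae_of_ae_map (by fun_prop) this] with ω hω using by linarith

/-- The mutual information of `Y` and `G` when `Y - L(G)` is uncorrelated with `G`. -/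
lemma mutualInfo_eq_of_residual (G : F →L[ℝ] E) (Y R : F →L[ℝ] ℝ) (L : E →L[ℝ] ℝ)
    (hL : Y = R + L.comp G)
    (horth : ∀ L' : E →L[ℝ] ℝ, covarianceBilinDual μ R (L'.comp G) = 0)
    (hR : 0 < covarianceBilinDual μ R R) (hY : 0 < covarianceBilinDual μ Y Y) :
    mutualInfo μ G Y = ENNReal.ofReal
      (Real.log (covarianceBilinDual μ Y Y / covarianceBilinDual μ R R) / 2) := by
  have hG : Measurable G := G.continuous.measurable
  have hYm : Measurable Y := Y.continuous.measurable
  have hRY : ∀ ω, Y ω - (L (G ω) + ∫ ω', R ω' ∂μ) = R ω - ∫ ω', R ω' ∂μ := fun ω => by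
    rw [hL]; simp only [add_apply, ContinuousLinearMap.comp_apply]; ring
  have key := klDiv_map_prodMk_gaussianKernel μ hG hYm
    (m := fun g => L g + ∫ ω', R ω' ∂μ) (m' := fun _ => ∫ ω', Y ω' ∂μ)
    (r := (covarianceBilinDual μ R R).toNNReal) (s := (covarianceBilinDual μ Y Y).toNNReal)
    (by fun_prop) (by fun_prop) (by simpa using hR) (by simpa using hY)
    (by
      simp_rw [hRY]
      exact (indepFun_of_covarianceBilinDual_eq_zero G R horth).comp measurable_id
        (measurable_id.sub_const _))
    (by simp_rw [hRY]; exact map_sub_integral_eq_gaussianReal R)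
    (map_sub_integral_eq_gaussianReal Y)
  rw [Real.coe_toNNReal _ hR.le, Real.coe_toNNReal _ hY.le] at key
  rw [← key, mutualInfo]
  congr 1
  have hYlaw : μ.map Y = gaussianReal (∫ ω, Y ω ∂μ) (covarianceBilinDual μ Y Y).toNNReal := by
    have hg : HasGaussianLaw Y μ := IsGaussian.hasGaussianLaw_id.map Y
    rw [hg.map_eq_gaussianReal,
      covarianceBilinDual_self_eq_variance IsGaussian.memLp_two_id]
  rw [hYlaw, ← Measure.compProd_const]
  congr 1

/-- The conditional mutual information of `X` and `Y` given `Z` when `R = Y - L(Z, X)` is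
uncorrelated with `(Z, X)` and `S = Y - L'(Z)` is uncorrelated with `Z`. -/
lemma condMutualInfo_eq_of_residual [StandardBorelSpace E] (X : F →L[ℝ] E) (Y : F →L[ℝ] ℝ)
    (Z : F →L[ℝ] E') (R S : F →L[ℝ] ℝ) (L : E' × E →L[ℝ] ℝ) (L' : E' →L[ℝ] ℝ)
    (hL : Y = R + L.comp (Z.prod X)) (hL' : Y = S + L'.comp Z)
    (hRorth : ∀ M : E' × E →L[ℝ] ℝ, covarianceBilinDual μ R (M.comp (Z.prod X)) = 0)
    (hSorth : ∀ M : E' →L[ℝ] ℝ, covarianceBilinDual μ S (M.comp Z) = 0)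
    (hS : 0 < covarianceBilinDual μ S S) :
    condMutualInfo μ X Y Z = if covarianceBilinDual μ R R = 0 then ∞ else ENNReal.ofReal
      (Real.log (covarianceBilinDual μ S S / covarianceBilinDual μ R R) / 2) := by
  have hX : Measurable X := X.continuous.measurable
  have hZ : Measurable Z := Z.continuous.measurable
  have hYm : Measurable Y := Y.continuous.measurable
  have hRY : ∀ ω, Y ω - (L (Z ω, X ω) + ∫ ω', R ω' ∂μ) = R ω - ∫ ω', R ω' ∂μ := fun ω => by
    rw [hL]; simp only [add_apply, ContinuousLinearMap.comp_apply,
      ContinuousLinearMap.prod_apply]; ring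
  have hSY : ∀ ω, Y ω - (L' (Z ω) + ∫ ω', S ω' ∂μ) = S ω - ∫ ω', S ω' ∂μ := fun ω => by
    rw [hL']; simp only [add_apply, ContinuousLinearMap.comp_apply]; ring
  have hSlaw : μ.map (fun ω => Y ω - (L' (Z ω) + ∫ ω', S ω' ∂μ)) =
      gaussianReal 0 (covarianceBilinDual μ S S).toNNReal := by
    simp_rw [hSY]; exact map_sub_integral_eq_gaussianReal S
  rw [condMutualInfo_eq_klDiv μ hX hYm hZ (m' := fun z => L' z + ∫ ω', S ω' ∂μ)
    (by fun_prop) (s := (covarianceBilinDual μ S S).toNNReal)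
    (by
      simp_rw [hSY]
      exact (indepFun_of_covarianceBilinDual_eq_zero Z S hSorth).comp measurable_id
        (measurable_id.sub_const _))
    hSlaw]
  split_ifs with h0
  · refine klDiv_map_prodMk_gaussianKernel_eq_top μ (hZ.prodMk hX) hYm
      (m := fun p => L p + ∫ ω', R ω' ∂μ) (by fun_prop) (by fun_prop) (by simpa using hS) ?_
    filter_upwards [ae_eq_integral_of_covarianceBilinDual_eq_zero R h0] with ω hω
    have := hRY ω
    linarith
  · have hR : 0 < covarianceBilinDual μ R R :=
      lt_of_le_of_ne (covarianceBilinDual_self_nonneg R) (Ne.symm h0)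
    have key := klDiv_map_prodMk_gaussianKernel μ (hZ.prodMk hX) hYm
      (m := fun p => L p + ∫ ω', R ω' ∂μ) (m' := fun p => L' p.1 + ∫ ω', S ω' ∂μ)
      (r := (covarianceBilinDual μ R R).toNNReal) (s := (covarianceBilinDual μ S S).toNNReal)
      (by fun_prop) (by fun_prop) (by simpa using hR) (by simpa using hS)
      (by
        simp_rw [hRY]
        exact (indepFun_of_covarianceBilinDual_eq_zero (Z.prod X) R hRorth).comp measurable_id
          (measurable_id.sub_const _))
      (by simp_rw [hRY]; exact map_sub_integral_eq_gaussianReal R)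
      hSlaw
    rw [Real.coe_toNNReal _ hR.le, Real.coe_toNNReal _ hS.le] at key
    exact key

lemma mutualInfo_real (w y R : F →L[ℝ] ℝ) (a : ℝ) (hy : y = R + a • w)
    (h : covarianceBilinDual μ R w = 0) (hR : 0 < covarianceBilinDual μ R R)
    (hY : 0 < covarianceBilinDual μ y y) :
    mutualInfo μ w y = ENNReal.ofReal
      (Real.log (covarianceBilinDual μ y y / covarianceBilinDual μ R R) / 2) :=
  mutualInfo_eq_of_residual w y R (a • .id ℝ ℝ) (by rw [hy]; ext; simp)
    (covarianceBilinDual_comp_real R w h) hR hY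

lemma mutualInfo_pair (w v y R : F →L[ℝ] ℝ) (a b : ℝ) (hy : y = R + a • w + b • v)
    (hw : covarianceBilinDual μ R w = 0) (hv : covarianceBilinDual μ R v = 0)
    (hR : 0 < covarianceBilinDual μ R R) (hY : 0 < covarianceBilinDual μ y y) :
    mutualInfo μ (fun ω => (w ω, v ω)) y = ENNReal.ofReal
      (Real.log (covarianceBilinDual μ y y / covarianceBilinDual μ R R) / 2) :=
  mutualInfo_eq_of_residual (w.prod v) y R (a • .fst ℝ ℝ ℝ + b • .snd ℝ ℝ ℝ)
    (by rw [hy]; ext; simp [add_assoc])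
    (covarianceBilinDual_comp_prod R w v (covarianceBilinDual_comp_real R w hw)
      (covarianceBilinDual_comp_real R v hv)) hR hY

lemma condMutualInfo_real (u x w R S : F →L[ℝ] ℝ) (a b a' : ℝ) (hR : x = R + a • w + b • u)
    (hS : x = S + a' • w) (hRw : covarianceBilinDual μ R w = 0)
    (hRu : covarianceBilinDual μ R u = 0) (hSw : covarianceBilinDual μ S w = 0)
    (hpos : 0 < covarianceBilinDual μ S S) :
    condMutualInfo μ u x w = if covarianceBilinDual μ R R = 0 then ∞ else ENNReal.ofReal
      (Real.log (covarianceBilinDual μ S S / covarianceBilinDual μ R R) / 2) :=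
  condMutualInfo_eq_of_residual u x w R S (a • .fst ℝ ℝ ℝ + b • .snd ℝ ℝ ℝ) (a' • .id ℝ ℝ)
    (by rw [hR]; ext; simp [add_assoc]) (by rw [hS]; ext; simp)
    (covarianceBilinDual_comp_prod R w u (covarianceBilinDual_comp_real R w hRw)
      (covarianceBilinDual_comp_real R u hRu)) (covarianceBilinDual_comp_real S w hSw) hpos

lemma condMutualInfo_pair (u x w y R S : F →L[ℝ] ℝ) (a b c a' b' : ℝ)
    (hR : x = R + a • w + b • y + c • u)
    (hS : x = S + a' • w + b' • y) (hRw : covarianceBilinDual μ R w = 0)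
    (hRy : covarianceBilinDual μ R y = 0)
    (hRu : covarianceBilinDual μ R u = 0) (hSw : covarianceBilinDual μ S w = 0)
    (hSy : covarianceBilinDual μ S y = 0) (hpos : 0 < covarianceBilinDual μ S S) :
    condMutualInfo μ u x (fun ω => (w ω, y ω)) =
      if covarianceBilinDual μ R R = 0 then ∞ else ENNReal.ofReal
      (Real.log (covarianceBilinDual μ S S / covarianceBilinDual μ R R) / 2) :=
  condMutualInfo_eq_of_residual u x (w.prod y) R S
    ((a • ContinuousLinearMap.fst ℝ ℝ ℝ + b • ContinuousLinearMap.snd ℝ ℝ ℝ).comp (.fst ℝ (ℝ × ℝ) ℝ) + c • .snd ℝ (ℝ × ℝ) ℝ)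
    (a' • .fst ℝ ℝ ℝ + b' • .snd ℝ ℝ ℝ)
    (by rw [hR]; ext; simp [add_assoc]) (by rw [hS]; ext; simp [add_assoc])
    (covarianceBilinDual_comp_prod R (w.prod y) u
      (covarianceBilinDual_comp_prod R w y (covarianceBilinDual_comp_real R w hRw)
        (covarianceBilinDual_comp_real R y hRy)) (covarianceBilinDual_comp_real R u hRu))
    (covarianceBilinDual_comp_prod S w y (covarianceBilinDual_comp_real S w hSw)
      (covarianceBilinDual_comp_real S y hSy)) hpos

end GaussianDivergence

/-! ### Minimising over the power split. -/

section ClosedFormula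

/-- The cost of the Gaussian scheme with `s² = P - B` spent on cancelling the state is at least the
closed formula. -/
lemma optimalCost_le_of_sqrt {Q N P q p s : ℝ} (hN : 0 < N) (hq : 0 < q) (hp : 0 ≤ p)
    (hQ : Q = q ^ 2) (hP : P = p ^ 2) (hs : 0 ≤ s) (hsp : s ≤ p) :
    optimalCost Q N P ≤ N * (q - s) ^ 2 / ((q - s) ^ 2 + (p ^ 2 - s ^ 2) + N) := by
  have hps : 0 ≤ p ^ 2 - s ^ 2 := by nlinarith
  have hden : 0 < (q - s) ^ 2 + (p ^ 2 - s ^ 2) + N := by positivity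
  have hQ0 : 0 < Q := by rw [hQ]; positivity
  unfold optimalCost
  split_ifs with h
  · rw [div_le_div_iff₀ hQ0 hden, hQ, hP]
    nlinarith [sq_nonneg (q ^ 2 - 2 * q * s + p ^ 2 + N - (q ^ 2 - N - p ^ 2)), hN,
      mul_nonneg hN.le (sq_nonneg (q * s - p ^ 2 - N))]
  · unfold linearCost
    split_ifs with hPQ
    · have hpq : p ≤ q := by
        rw [hP, hQ] at hPQ
        exact (pow_le_pow_iff_left₀ hp hq.le two_ne_zero).1 hPQ
      -- Outside the first branch the stationary point (p² + N)/q is not below p, so s = p is the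
      -- relevant endpoint. The negation gives (p² + N)² ≤ p²q², which is P ∈ [P₁, P₂], and also
      -- forces Q > 4N.
      have hkey : p * q ≤ p ^ 2 + N := by
        by_contra hcon
        push Not at hcon
        apply h
        have h4 : 4 * N < Q := by
          rw [hQ]; nlinarith [sq_nonneg (2 * p - q)]
        refine ⟨h4, ?_⟩
        have hle : (p ^ 2 + N) ^ 2 ≤ (p * q) ^ 2 := by gcongr
        have hdisc : (2 * P - (Q - 2 * N)) ^ 2 ≤ Q ^ 2 - 4 * Q * N := by
          rw [hP, hQ]; nlinarith
        have habs := Real.abs_le_sqrt hdisc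
        rw [abs_le] at habs
        unfold powerOne powerTwo
        constructor <;> linarith [habs.1, habs.2]
      rw [hQ, hP, Real.sqrt_sq hq.le, Real.sqrt_sq hp,
        div_le_div_iff₀ (by positivity) hden]
      have hτ : 0 ≤ q - p := by linarith
      have hd : 0 ≤ p - s := by linarith
      have e : N * (q - s) ^ 2 * ((q - p) ^ 2 + N) -
          (q - p) ^ 2 * N * ((q - s) ^ 2 + (p ^ 2 - s ^ 2) + N) =
          N * ((p - s) * (2 * (q - p) * (p ^ 2 + N - p * q) +
            (p - s) * ((q - p) ^ 2 + N))) := by ring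
      have : 0 ≤ N * ((p - s) * (2 * (q - p) * (p ^ 2 + N - p * q) +
            (p - s) * ((q - p) ^ 2 + N))) := by
        have : 0 ≤ p ^ 2 + N - p * q := by linarith
        positivity
      linarith
    · positivity

/-- The ratio NC/(C + B + N) increases in C and decreases in B. With s² = a²Q + v, Cauchy–Schwarz in
the form −a√Q ≤ s gives (√Q − s)² ≤ (1+a)²Q + v, and the power bound gives b ≤ P − s²; the
one-parameter bound then applies. The power hypothesis is an inequality because a variance may be
smaller than the second moment. -/
lemma optimalCost_le {Q N P a v b : ℝ} (hQ : 0 < Q) (hN : 0 < N) (hv : 0 ≤ v) (hb : 0 ≤ b)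
    (hP : a ^ 2 * Q + b + v ≤ P) :
    optimalCost Q N P ≤
      N * ((1 + a) ^ 2 * Q + v) / ((1 + a) ^ 2 * Q + v + b + N) := by
  have hP0 : 0 ≤ P := le_trans (by positivity) hP
  set s := √(a ^ 2 * Q + v) with hs
  have hs2 : s ^ 2 = a ^ 2 * Q + v := Real.sq_sqrt (by positivity)
  have hq2 : √Q ^ 2 = Q := Real.sq_sqrt hQ.le
  have hq : 0 < √Q := Real.sqrt_pos.2 hQ
  have hs0 : 0 ≤ s := Real.sqrt_nonneg _
  have hsp : s ≤ √P := Real.sqrt_le_sqrt (by linarith)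
  refine (optimalCost_le_of_sqrt hN hq (Real.sqrt_nonneg P) hq2.symm
    (Real.sq_sqrt hP0).symm hs0 hsp).trans ?_
  have hp2 : √P ^ 2 = P := Real.sq_sqrt hP0
  have hC : (√Q - s) ^ 2 ≤ (1 + a) ^ 2 * Q + v := by
    have : -(a * √Q) ≤ s := by
      refine Real.le_sqrt_of_sq_le ?_
      nlinarith
    nlinarith
  have hB : b ≤ √P ^ 2 - s ^ 2 := by rw [hp2, hs2]; linarith
  rw [div_le_div_iff₀ (by nlinarith [sq_nonneg (√Q - s)]) (by positivity)]
  have h1 : 0 ≤ √P ^ 2 - s ^ 2 := hb.trans hB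
  have h2 := mul_le_mul hC (add_le_add_left hB N) (by positivity) (by positivity)
  nlinarith

end ClosedFormula

/-! ### Projections and Bessel's inequality for a semidefinite form. -/

section PosSemidef

variable {V : Type*} [AddCommGroup V] [Module ℝ V] {B : LinearMap.BilinForm ℝ V}

/-- Null vectors of a semidefinite form lie in its kernel. This is what makes degenerate Gaussian
families harmless. -/
lemma bilin_eq_zero_of_self_eq_zero (hs : ∀ x y, B x y = B y x) (hp : ∀ x, 0 ≤ B x x)
    {v : V} (hv : B v v = 0) (y : V) : B y v = 0 := by
  by_contra h
  -- The multiple of v is chosen so that the form takes the value −1 here.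
  have h1 := hp (y - ((B y y + 1) / (2 * B y v)) • v)
  simp only [map_sub, map_smul, LinearMap.sub_apply, LinearMap.smul_apply, smul_eq_mul, hv,
    hs v y] at h1
  have h2 : (B y y + 1) / (2 * B y v) * B y v = (B y y + 1) / 2 := by field_simp
  rw [h2] at h1
  linarith

lemma exists_residual_one (hs : ∀ x y, B x y = B y x) (hp : ∀ x, 0 ≤ B x x) (y v : V) :
    ∃ c : ℝ, B (y - c • v) v = 0 := by
  by_cases hv : B v v = 0
  · exact ⟨0, by simpa using bilin_eq_zero_of_self_eq_zero hs hp hv y⟩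
  · refine ⟨B y v / B v v, ?_⟩
    simp only [map_sub, map_smul, LinearMap.sub_apply, LinearMap.smul_apply, smul_eq_mul]
    field_simp
    simp

/-- Gram–Schmidt: make w orthogonal to v, then subtract the two projections. Nothing is assumed
about linear independence. -/
lemma exists_residual_two (hs : ∀ x y, B x y = B y x) (hp : ∀ x, 0 ≤ B x x) (y v w : V) :
    ∃ a b : ℝ, B (y - a • v - b • w) v = 0 ∧ B (y - a • v - b • w) w = 0 := by
  obtain ⟨c, hc⟩ := exists_residual_one hs hp w v
  obtain ⟨a, ha⟩ := exists_residual_one hs hp y v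
  obtain ⟨b, hb⟩ := exists_residual_one hs hp (y - a • v) (w - c • v)
  have e : y - (a - b * c) • v - b • w = y - a • v - b • (w - c • v) := by module
  have h1 : B (y - a • v - b • (w - c • v)) v = 0 := by
    rw [map_sub, LinearMap.sub_apply, ha, map_smul, LinearMap.smul_apply, hc]; simp
  refine ⟨a - b * c, b, by rw [e]; exact h1, ?_⟩
  rw [e]
  rw [map_sub, map_smul, h1, smul_zero, sub_zero] at hb
  exact hb

lemma exists_residual_three (hs : ∀ x y, B x y = B y x) (hp : ∀ x, 0 ≤ B x x) (y u v w : V) :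
    ∃ a b c : ℝ, B (y - a • u - b • v - c • w) u = 0 ∧ B (y - a • u - b • v - c • w) v = 0 ∧
      B (y - a • u - b • v - c • w) w = 0 := by
  obtain ⟨a', b', hw1, hw2⟩ := exists_residual_two hs hp w u v
  obtain ⟨a, b, hy1, hy2⟩ := exists_residual_two hs hp y u v
  obtain ⟨c, hc⟩ := exists_residual_one hs hp (y - a • u - b • v) (w - a' • u - b' • v)
  have e : y - (a - c * a') • u - (b - c * b') • v - c • w =
      y - a • u - b • v - c • (w - a' • u - b' • v) := by module
  have h1 : B (y - a • u - b • v - c • (w - a' • u - b' • v)) u = 0 := by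
    rw [map_sub, LinearMap.sub_apply, hy1, map_smul, LinearMap.smul_apply, hw1]; simp
  have h2 : B (y - a • u - b • v - c • (w - a' • u - b' • v)) v = 0 := by
    rw [map_sub, LinearMap.sub_apply, hy2, map_smul, LinearMap.smul_apply, hw2]; simp
  refine ⟨a - c * a', b - c * b', c, by rw [e]; exact h1, by rw [e]; exact h2, ?_⟩
  rw [e]
  rw [map_sub, map_sub, map_smul, map_smul, h1, h2, smul_zero, sub_zero, smul_zero, sub_zero] at hc
  exact hc

/-- Bessel's inequality for two orthogonal vectors. -/
lemma bessel_two (hs : ∀ x y, B x y = B y x) (hp : ∀ x, 0 ≤ B x x) (d e f : V)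
    (hef : B e f = 0) (c c' : ℝ) (he : B e d = c * B e e) (hf : B f d = c' * B f f) :
    c ^ 2 * B e e + c' ^ 2 * B f f ≤ B d d := by
  have h := hp (d - c • e - c' • f)
  simp only [map_sub, map_smul, LinearMap.sub_apply, LinearMap.smul_apply, smul_eq_mul,
    hs d e, hs d f, hs f e, hef, he, hf] at h
  nlinarith

/-- A lower bound on the estimation error from the residual `R` of the state `x` and the part
`N V - v z` of the action that the output does not reveal. -/
lemma estimation_error_ge (hs : ∀ x y, B x y = B y x) (hp : ∀ x, 0 ≤ B x x)
    {x w v z x₁ y u₂ R : V} {a b N : ℝ} (hN : 0 < N)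
    (hx₁ : ∀ l, B x₁ l = (1 + a) * B x l + b * B w l + B v l)
    (hy : ∀ l, B y l = (1 + a) * B x l + b * B w l + B v l + B z l)
    (hvx : B v x = 0) (hvw : B v w = 0) (hzx : B z x = 0) (hzw : B z w = 0)
    (hzv : B z v = 0) (hzz : B z z = N)
    (hRx : B R x = B R R) (hRw : B R w = 0) (hRy : B R y = 0) (hRu : B R u₂ = 0)
    (hRv : N * B R v = B v v * B R z) (hvu : N * B v u₂ = B v v * B z u₂) :
    B v v * N / (B v v + N) + ((1 + a) * N / (B v v + N)) ^ 2 * B R R ≤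
      B (x₁ - u₂) (x₁ - u₂) := by
  have hv0 : 0 ≤ B v v := hp v
  have hpos : 0 < B v v + N := by linarith
  have hy' := hy R
  rw [hs y, hRy, hs x, hRx, hs w, hRw, hs v, hs z] at hy'
  -- Orthogonality to y reads (1+a)·B R R + B R v + B R z = 0; together with the proportion `hRv` it
  -- determines B R v.
  have hRv' : B R v = - (B v v * (1 + a) * B R R) / (B v v + N) := by
    rw [eq_div_iff hpos.ne']; nlinarith
  -- The vector N v − (B v v) z is B v v + N times the error of estimating v from v + z. It is
  -- orthogonal to R by `hRv` and to u₂ by `hvu`; the two scalars are the coefficients of x₁ − u₂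
  -- along it and along R.
  have h := bessel_two hs hp (x₁ - u₂) (N • v - B v v • z) R
    (by simp only [map_sub, map_smul, LinearMap.sub_apply, LinearMap.smul_apply, smul_eq_mul,
          hs v R, hs z R]; linarith)
    (1 / (B v v + N)) ((1 + a) * N / (B v v + N))
    (by
      simp only [map_sub, map_smul, LinearMap.sub_apply, LinearMap.smul_apply, smul_eq_mul,
          hs _ x₁, hx₁, hs x, hs w, hvx, hvw, hzx, hzw, hzv, hs v z, hzz]
      field_simp
      linear_combination (-(B v v + N)) * hvu)
    (by
      simp only [map_sub, hs R x₁, hx₁, hs x R, hs w R, hs v R, hRx, hRw, hRu, hRv']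
      field_simp
      ring)
  have e : B (N • v - B v v • z) (N • v - B v v • z) = N * B v v * (B v v + N) := by
    simp only [map_sub, map_smul, LinearMap.sub_apply, LinearMap.smul_apply, smul_eq_mul,
      hzv, hs v z, hzz]
    ring
  rw [e] at h
  refine le_trans (le_of_eq ?_) h
  field_simp

/-- At the least admissible r the two sides differ by N v b / ((v+N)((1+a)²Q + v + b + N)) ≥ 0, with
equality when v or b vanishes. -/
lemma schemeCost_le_error {a Q N v b r : ℝ} (hQ : 0 < Q) (hN : 0 < N) (hv : 0 ≤ v) (hb : 0 ≤ b)
    (hr : Q * (v + N) / ((1 + a) ^ 2 * Q + b + v + N) ≤ r) :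
    N * ((1 + a) ^ 2 * Q + v) / ((1 + a) ^ 2 * Q + v + b + N) ≤
      v * N / (v + N) + ((1 + a) * N / (v + N)) ^ 2 * r := by
  have h1 : ((1 + a) * N / (v + N)) ^ 2 * (Q * (v + N) / ((1 + a) ^ 2 * Q + b + v + N)) ≤
      ((1 + a) * N / (v + N)) ^ 2 * r := by gcongr
  refine le_trans ?_ (add_le_add_right h1 _)
  have h2 : v * N / (v + N) + ((1 + a) * N / (v + N)) ^ 2 *
      (Q * (v + N) / ((1 + a) ^ 2 * Q + b + v + N)) -
      N * ((1 + a) ^ 2 * Q + v) / ((1 + a) ^ 2 * Q + v + b + N) =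
      N * (v * b) / ((v + N) * ((1 + a) ^ 2 * Q + v + b + N)) := by
    have h3 : (1 + a) ^ 2 * Q + b + v + N = (1 + a) ^ 2 * Q + v + b + N := by ring
    rw [h3]
    field_simp
    ring
  have h4 : 0 ≤ N * (v * b) / ((v + N) * ((1 + a) ^ 2 * Q + v + b + N)) := by positivity
  linarith

end PosSemidef

/-- The hypothesis q ≤ t makes the right-hand logarithm nonnegative, so the truncation in
`ENNReal.ofReal` can be removed and the logarithms compared. -/
lemma div_le_div_of_ofReal_log_le {s r t q : ℝ} (hs : 0 < s) (hr : 0 < r) (hq : 0 < q)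
    (hqt : q ≤ t)
    (h : ENNReal.ofReal (Real.log (s / r) / 2) ≤ ENNReal.ofReal (Real.log (t / q) / 2)) :
    s * q ≤ t * r := by
  have ht : 0 < t := hq.trans_le hqt
  have h0 : 0 ≤ Real.log (t / q) / 2 :=
    div_nonneg (Real.log_nonneg ((one_le_div hq).2 hqt)) two_pos.le
  rw [ENNReal.ofReal_le_ofReal_iff h0] at h
  have h1 : Real.log (s / r) ≤ Real.log (t / q) := by linarith
  rw [Real.log_le_log_iff (by positivity) (by positivity), div_le_div_iff₀ hr hq] at h1
  linarith

/-! ### Lower bounds from second-order relations. -/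

section Converse

variable {F : Type*} [NormedAddCommGroup F] [NormedSpace ℝ F] [MeasurableSpace F] [BorelSpace F]

/-- The second-order relations between the state `x`, the auxiliary variable `w`, the action `u`,
the noise `z`, the interim state `x₁ = x + u` and the output `y = x₁ + z`. -/
structure IsChannelModel (μ : Measure F) (Q N : ℝ) (x w u z x₁ y : F →L[ℝ] ℝ) : Prop where
  state_var : covarianceBilinDual μ x x = Q
  state_aux : covarianceBilinDual μ x w = 0
  noise_var : covarianceBilinDual μ z z = N
  noise_state : covarianceBilinDual μ z x = 0
  noise_aux : covarianceBilinDual μ z w = 0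
  noise_action : covarianceBilinDual μ z u = 0
  interim : ∀ l, covarianceBilinDual μ x₁ l =
    covarianceBilinDual μ x l + covarianceBilinDual μ u l
  output : ∀ l, covarianceBilinDual μ y l =
    covarianceBilinDual μ x₁ l + covarianceBilinDual μ z l

variable {μ : Measure F} {Q N : ℝ} {x w u z x₁ y : F →L[ℝ] ℝ}

/-- The action decomposed as `u = a x + b w + v` with `v` uncorrelated with `x` and `w`. -/
lemma IsChannelModel.exists_decomposition (h : IsChannelModel μ Q N x w u z x₁ y) (hQ : 0 < Q) :
    ∃ (a b : ℝ) (v : F →L[ℝ] ℝ), v = u - a • x - b • w ∧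
      covarianceBilinDual μ v x = 0 ∧ covarianceBilinDual μ v w = 0 ∧
      covarianceBilinDual μ z v = 0 ∧
      (∀ l, covarianceBilinDual μ x₁ l = (1 + a) * covarianceBilinDual μ x l +
        b * covarianceBilinDual μ w l + covarianceBilinDual μ v l) ∧
      (∀ l, covarianceBilinDual μ y l = (1 + a) * covarianceBilinDual μ x l +
        b * covarianceBilinDual μ w l + covarianceBilinDual μ v l +
        covarianceBilinDual μ z l) ∧
      covarianceBilinDual μ u u = a ^ 2 * Q + b ^ 2 * covarianceBilinDual μ w w +
        covarianceBilinDual μ v v := by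
  have hs : ∀ l l', covarianceBilinDual μ l l' = covarianceBilinDual μ l' l :=
    covarianceBilinDual_comm
  obtain ⟨b, hb⟩ := exists_residual_one (B := (covarianceBilinDual μ).toBilinForm)
    covarianceBilinDual_comm covarianceBilinDual_self_nonneg u w
  replace hb : covarianceBilinDual μ (u - b • w) w = 0 := hb
  have hwx : covarianceBilinDual μ w x = 0 := by rw [hs]; exact h.state_aux
  have hux : covarianceBilinDual μ u x / Q * Q = covarianceBilinDual μ u x := by field_simp
  -- Since x and w are uncorrelated, the two regression coefficients are found separately. Only Q is
  -- known to be positive; w may be degenerate.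
  set a := covarianceBilinDual μ u x / Q with ha
  have hvx : covarianceBilinDual μ (u - a • x - b • w) x = 0 := by
    simp only [map_sub, map_smul, sub_apply, smul_apply, smul_eq_mul, hwx, h.state_var, hux]
    ring
  have hvw : covarianceBilinDual μ (u - a • x - b • w) w = 0 := by
    simp only [map_sub, map_smul, sub_apply, smul_apply, smul_eq_mul, h.state_aux] at hb ⊢
    linarith
  obtain ⟨v, hv⟩ : ∃ v, v = u - a • x - b • w := ⟨_, rfl⟩
  rw [← hv] at hvx hvw
  have hu : u = v + a • x + b • w := by rw [hv]; module
  have hul : ∀ l, covarianceBilinDual μ u l = covarianceBilinDual μ v l +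
      a * covarianceBilinDual μ x l + b * covarianceBilinDual μ w l := fun l => by
    rw [hu]; simp only [map_add, map_smul, add_apply, smul_apply, smul_eq_mul]
  refine ⟨a, b, v, hv, hvx, hvw, ?_, fun l => ?_, fun l => ?_, ?_⟩
  · rw [hv]
    simp only [map_sub, map_smul, smul_eq_mul, h.noise_state, h.noise_aux, h.noise_action]
    ring
  · rw [h.interim, hul]; ring
  · rw [h.output, h.interim, hul]; ring
  · rw [hul, hs v u, hs x u, hs w u, hul, hul, hul, hs x v, hvx, hs w v, hvw, hwx, h.state_aux,
      h.state_var]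
    ring

variable [CompleteSpace F] [SecondCountableTopology F] [IsGaussian μ]

/-- Here Var(X₀ | W₁, Y₁) = Q(v+N)/T with T = Var(Y₁ | W₁), so T cancels from the information
constraint and the bound on r remains. Hypothesis `hM` is the second-order trace of U₂ being
generated from X₀, W₁, Y₁. -/
theorem IsChannelModel.optimalCost_le_of_feedback {P : ℝ} {u₂ : F →L[ℝ] ℝ}
    (h : IsChannelModel μ Q N x w u z x₁ y) (hQ : 0 < Q) (hN : 0 < N)
    (hP : covarianceBilinDual μ u u ≤ P)
    (hM : ∀ α β γ δ : ℝ, covarianceBilinDual μ (α • x + β • w + γ • u + δ • z) x = 0 →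
      covarianceBilinDual μ (α • x + β • w + γ • u + δ • z) w = 0 →
      covarianceBilinDual μ (α • x + β • w + γ • u + δ • z) y = 0 →
      covarianceBilinDual μ (α • x + β • w + γ • u + δ • z) u₂ = 0)
    (hI : condMutualInfo μ u₂ x (fun ω => (w ω, y ω)) ≤ mutualInfo μ w y) :
    optimalCost Q N P ≤ covarianceBilinDual μ (x₁ - u₂) (x₁ - u₂) := by
  obtain ⟨a, b, v, hv, hvx, hvw, hzv, hx₁, hy, huu⟩ := h.exists_decomposition hQ
  have hs : ∀ l l', covarianceBilinDual μ l l' = covarianceBilinDual μ l' l :=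
    covarianceBilinDual_comm
  have hv0 : 0 ≤ covarianceBilinDual μ v v := covarianceBilinDual_self_nonneg v
  have hw0 : 0 ≤ covarianceBilinDual μ w w := covarianceBilinDual_self_nonneg w
  have hyy : covarianceBilinDual μ y y = (1 + a) ^ 2 * Q + b ^ 2 * covarianceBilinDual μ w w +
      covarianceBilinDual μ v v + N := by
    rw [hy, hs x y, hs w y, hs v y, hs z y, hy, hy, hy, hy, hs w x, h.state_aux, hvx, hvw,
      hs x v, hvx, hs w v, hvw, hs x z, hs w z, hs v z, h.noise_state, h.noise_aux, hzv,
      h.noise_var, h.state_var]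
    ring
  have hA : 0 ≤ (1 + a) ^ 2 * Q := by positivity
  have hB : 0 ≤ b ^ 2 * covarianceBilinDual μ w w := by positivity
  have hyw : covarianceBilinDual μ y w = b * covarianceBilinDual μ w w := by
    rw [hy, h.state_aux, hvw, h.noise_aux]; ring
  have hyx : covarianceBilinDual μ y x = (1 + a) * Q := by
    rw [hy, hs w x, h.state_aux, hvx, h.noise_state, h.state_var]; ring
  -- the residual of the output given `w`
  have hT : covarianceBilinDual μ (y - b • w) (y - b • w) =
      (1 + a) ^ 2 * Q + covarianceBilinDual μ v v + N := by
    simp only [map_sub, map_smul, sub_apply, smul_apply, smul_eq_mul, hs w y, hyw, hyy]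
    ring
  have hT0 : 0 < covarianceBilinDual μ (y - b • w) (y - b • w) := by rw [hT]; linarith
  have hMI := mutualInfo_real w y (y - b • w) b (by module)
    (by simp only [map_sub, map_smul, sub_apply, smul_apply, smul_eq_mul, hyw]; ring) hT0
    (by rw [hyy]; linarith)
  -- the residual of the state given `w` and the output
  obtain ⟨β, hβ⟩ : ∃ β : ℝ, β * ((1 + a) ^ 2 * Q + covarianceBilinDual μ v v + N) = (1 + a) * Q :=
    ⟨(1 + a) * Q / ((1 + a) ^ 2 * Q + covarianceBilinDual μ v v + N),
      div_mul_cancel₀ _ (by linarith)⟩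
  have hSw : covarianceBilinDual μ (x + (β * b) • w - β • y) w = 0 := by
    simp only [map_sub, map_add, map_smul, sub_apply, add_apply, smul_apply, smul_eq_mul, hyw,
      h.state_aux]
    ring
  have hSy : covarianceBilinDual μ (x + (β * b) • w - β • y) y = 0 := by
    simp only [map_sub, map_add, map_smul, sub_apply, add_apply, smul_apply, smul_eq_mul,
      hs x y, hs w y, hyx, hyw, hyy]
    linear_combination -hβ
  have hSS : covarianceBilinDual μ (x + (β * b) • w - β • y) (x + (β * b) • w - β • y) =
      Q * (covarianceBilinDual μ v v + N) /
        ((1 + a) ^ 2 * Q + covarianceBilinDual μ v v + N) := by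
    have h1 : covarianceBilinDual μ (x + (β * b) • w - β • y) (x + (β * b) • w - β • y) =
        covarianceBilinDual μ (x + (β * b) • w - β • y) x := by
      rw [map_sub, map_add, map_smul, map_smul, hSw, hSy]; simp
    rw [h1, eq_div_iff (by linarith)]
    simp only [map_sub, map_add, map_smul, sub_apply, add_apply, smul_apply, smul_eq_mul,
      hs w x, h.state_aux, hyx, h.state_var]
    linear_combination (-(1 + a) * Q) * hβ
  have hS0 : 0 < covarianceBilinDual μ (x + (β * b) • w - β • y) (x + (β * b) • w - β • y) := by
    rw [hSS]; positivity
  -- the residual of the state given `w`, the output and the estimate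
  obtain ⟨α, α', α'', hRw, hRy, hRu⟩ := exists_residual_three
    (B := (covarianceBilinDual μ).toBilinForm)
    covarianceBilinDual_comm covarianceBilinDual_self_nonneg x w y u₂
  obtain ⟨R, hR⟩ : ∃ R, R = x - α • w - α' • y - α'' • u₂ := ⟨_, rfl⟩
  rw [← hR] at hRw hRy hRu
  replace hRw : covarianceBilinDual μ R w = 0 := hRw
  replace hRy : covarianceBilinDual μ R y = 0 := hRy
  replace hRu : covarianceBilinDual μ R u₂ = 0 := hRu
  have hRx : covarianceBilinDual μ R x = covarianceBilinDual μ R R := by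
    have e : x = R + α • w + α' • y + α'' • u₂ := by rw [hR]; module
    conv_lhs => rw [e]
    simp only [map_add, map_smul, hRw, hRy, hRu]
    simp
  have hcond := condMutualInfo_pair u₂ x w y R (x + (β * b) • w - β • y) α α' α'' (-(β * b)) β
    (by rw [hR]; module) (by module) hRw hRy hRu hSw hSy hS0
  rw [hcond, hMI] at hI
  -- A vanishing residual would make the conditional information infinite while the mutual
  -- information is finite.
  split_ifs at hI with hR0
  · simp at hI
  have hRpos : 0 < covarianceBilinDual μ R R :=
    lt_of_le_of_ne (covarianceBilinDual_self_nonneg R) (Ne.symm hR0)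
  have hbound := div_le_div_of_ofReal_log_le hS0 hRpos hT0 (by rw [hT, hyy]; linarith) hI
  -- This is the inequality Q(v+N) ≤ Var Y₁ · Var R.
  rw [hT, hSS, hyy, div_mul_cancel₀ _ (by linarith)] at hbound
  -- the hidden part of the action
  have hvu : N * covarianceBilinDual μ v u₂ =
      covarianceBilinDual μ v v * covarianceBilinDual μ z u₂ := by
    have e : (-(N * a)) • x + (-(N * b)) • w + N • u + (-covarianceBilinDual μ v v) • z =
        N • v - covarianceBilinDual μ v v • z := by rw [hv]; module
    have h1 := hM (-(N * a)) (-(N * b)) N (-covarianceBilinDual μ v v)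
    rw [e] at h1
    simp only [map_sub, map_smul, sub_apply, smul_apply, smul_eq_mul, hvx, hvw,
      h.noise_state, h.noise_aux, hs v y, hs z y, hy, hs x v, hs w v, hs x z, hs w z, hzv,
      hs v z, h.noise_var] at h1
    linarith [h1 (by ring) (by ring) (by ring)]
  -- The vector N v − (Var v) z is uncorrelated with x, w, y and, by `hvu`, with u₂, hence with
  -- their combination R.
  have hRv : N * covarianceBilinDual μ R v =
      covarianceBilinDual μ v v * covarianceBilinDual μ R z := by
    rw [hR]
    simp only [map_sub, map_smul, sub_apply, smul_apply, smul_eq_mul, hs x v, hs w v, hs x z,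
      hs w z, hvx, hvw, h.noise_state, h.noise_aux, hy, hzv, hs v z, h.noise_var, hs u₂ v,
      hs u₂ z]
    linear_combination (-α'') * hvu
  refine (optimalCost_le hQ hN hv0 hB (huu ▸ hP)).trans ?_
  refine (schemeCost_le_error (r := covarianceBilinDual μ R R) hQ hN hv0 hB ?_).trans ?_
  · rw [div_le_iff₀ (by linarith)]; linarith
  · exact estimation_error_ge (B := (covarianceBilinDual μ).toBilinForm) (b := b)
      covarianceBilinDual_comm covarianceBilinDual_self_nonneg hN hx₁ hy hvx hvw h.noise_state
      h.noise_aux hzv h.noise_var hRx hRw hRy hRu hRv hvu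

/-- Let R be the residual of X₀ given (W₁, W₂) and T that of Y₁. The constraint says Q · Var T ≤ Var
Y₁ · Var R, and observing Y₁ reduces Var R to Var R · (v+N)/Var T. This gives the same lower bound
Q(v+N)/Var Y₁ as with feedback. -/
theorem IsChannelModel.optimalCost_le_of_auxiliary {P : ℝ} {w₂ u₂ : F →L[ℝ] ℝ}
    (h : IsChannelModel μ Q N x w u z x₁ y) (hQ : 0 < Q) (hN : 0 < N)
    (hP : covarianceBilinDual μ u u ≤ P)
    (hzw₂ : covarianceBilinDual μ z w₂ = 0)
    (hW : ∀ α β γ : ℝ, covarianceBilinDual μ (α • x + β • w + γ • u) x = 0 →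
      covarianceBilinDual μ (α • x + β • w + γ • u) w = 0 →
      covarianceBilinDual μ (α • x + β • w + γ • u) w₂ = 0)
    (hM : ∀ α β γ δ ε : ℝ,
      covarianceBilinDual μ (α • x + β • w + γ • u + δ • z + ε • w₂) w = 0 →
      covarianceBilinDual μ (α • x + β • w + γ • u + δ • z + ε • w₂) w₂ = 0 →
      covarianceBilinDual μ (α • x + β • w + γ • u + δ • z + ε • w₂) y = 0 →
      covarianceBilinDual μ (α • x + β • w + γ • u + δ • z + ε • w₂) u₂ = 0)
    (hI : condMutualInfo μ w₂ x w ≤ mutualInfo μ (fun ω => (w ω, w₂ ω)) y) :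
    optimalCost Q N P ≤ covarianceBilinDual μ (x₁ - u₂) (x₁ - u₂) := by
  obtain ⟨a, b, v, hv, hvx, hvw, hzv, hx₁, hy, huu⟩ := h.exists_decomposition hQ
  have hs : ∀ l l', covarianceBilinDual μ l l' = covarianceBilinDual μ l' l :=
    covarianceBilinDual_comm
  have hv0 : 0 ≤ covarianceBilinDual μ v v := covarianceBilinDual_self_nonneg v
  have hw0 : 0 ≤ covarianceBilinDual μ w w := covarianceBilinDual_self_nonneg w
  have hyy : covarianceBilinDual μ y y = (1 + a) ^ 2 * Q + b ^ 2 * covarianceBilinDual μ w w +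
      covarianceBilinDual μ v v + N := by
    rw [hy, hs x y, hs w y, hs v y, hs z y, hy, hy, hy, hy, hs w x, h.state_aux, hvx, hvw,
      hs x v, hvx, hs w v, hvw, hs x z, hs w z, hs v z, h.noise_state, h.noise_aux, hzv,
      h.noise_var, h.state_var]
    ring
  have hA : 0 ≤ (1 + a) ^ 2 * Q := by positivity
  have hB : 0 ≤ b ^ 2 * covarianceBilinDual μ w w := by positivity
  -- Given X₀ and W₁, the action and W₂ are drawn independently, so V is uncorrelated with W₂.
  have hvw₂ : covarianceBilinDual μ v w₂ = 0 := by
    have e : (-a) • x + (-b) • w + (1 : ℝ) • u = v := by rw [hv]; module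
    have h1 := hW (-a) (-b) 1
    rw [e] at h1
    exact h1 hvx hvw
  -- the residual of the state given `w` and `w₂`
  obtain ⟨α, α', hRw, hRw₂⟩ := exists_residual_two
    (B := (covarianceBilinDual μ).toBilinForm)
    covarianceBilinDual_comm covarianceBilinDual_self_nonneg x w w₂
  obtain ⟨R, hR⟩ : ∃ R, R = x - α • w - α' • w₂ := ⟨_, rfl⟩
  rw [← hR] at hRw hRw₂
  replace hRw : covarianceBilinDual μ R w = 0 := hRw
  replace hRw₂ : covarianceBilinDual μ R w₂ = 0 := hRw₂
  have hRx : covarianceBilinDual μ R x = covarianceBilinDual μ R R := by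
    have e : x = R + α • w + α' • w₂ := by rw [hR]; module
    conv_lhs => rw [e]
    simp only [map_add, map_smul, hRw, hRw₂]
    simp
  have hvR : covarianceBilinDual μ v R = 0 := by
    rw [hR]; simp only [map_sub, map_smul, smul_eq_mul, hvx, hvw, hvw₂]; ring
  have hzR : covarianceBilinDual μ z R = 0 := by
    rw [hR]; simp only [map_sub, map_smul, smul_eq_mul, h.noise_state, h.noise_aux, hzw₂]; ring
  have hyR : covarianceBilinDual μ y R = (1 + a) * covarianceBilinDual μ R R := by
    rw [hy, hs x R, hRx, hs w R, hRw, hvR, hzR]; ring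
  have hcond := condMutualInfo_real w₂ x w R x α α' 0 (by rw [hR]; module) (by module) hRw hRw₂
    h.state_aux (by rw [h.state_var]; exact hQ)
  -- the residual of the output given `w` and `w₂`
  obtain ⟨T, hT⟩ : ∃ T, T = y - ((1 + a) * α + b) • w - ((1 + a) * α') • w₂ := ⟨_, rfl⟩
  -- Substituting x = R + αw + α'w₂ in the output leaves T = (1+a)R + v + z, with three mutually
  -- uncorrelated terms.
  have hTl : ∀ l, covarianceBilinDual μ T l = (1 + a) * covarianceBilinDual μ R l +
      covarianceBilinDual μ v l + covarianceBilinDual μ z l := fun l => by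
    rw [hT, hR]
    simp only [map_sub, map_smul, sub_apply, smul_apply, smul_eq_mul, hy]
    ring
  have hR0 : 0 ≤ covarianceBilinDual μ R R := covarianceBilinDual_self_nonneg R
  have hTT : covarianceBilinDual μ T T =
      (1 + a) ^ 2 * covarianceBilinDual μ R R + covarianceBilinDual μ v v + N := by
    rw [hTl, hs R T, hs v T, hs z T, hTl, hTl, hTl, hvR, hzR, hs R v, hvR, hzv, hs R z, hzR,
      hs v z, hzv, h.noise_var]
    ring
  have hTpos : 0 < covarianceBilinDual μ T T := by rw [hTT]; positivity
  have hMI := mutualInfo_pair w w₂ y T ((1 + a) * α + b) ((1 + a) * α') (by rw [hT]; module)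
    (by rw [hTl, hRw, hvw, h.noise_aux]; ring) (by rw [hTl, hRw₂, hvw₂, hzw₂]; ring) hTpos
    (by rw [hyy]; linarith)
  rw [hcond, hMI] at hI
  split_ifs at hI with hR0'
  · simp at hI
  have hRpos : 0 < covarianceBilinDual μ R R := lt_of_le_of_ne hR0 (Ne.symm hR0')
  -- Used for Var T ≤ Var Y₁, the sign condition needed to compare the logarithms.
  have hxRR : covarianceBilinDual μ R R ≤ Q := by
    have h1 := covarianceBilinDual_self_nonneg (μ := μ) (x - R)
    simp only [map_sub, sub_apply, hs x R, hRx, h.state_var] at h1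
    linarith
  have hbound := div_le_div_of_ofReal_log_le (by rw [h.state_var]; exact hQ) hRpos hTpos
    (by rw [hTT, hyy]; nlinarith [sq_nonneg (1 + a)]) hI
  rw [hTT, hyy, h.state_var] at hbound
  -- the residual of the state given `w`, `w₂` and the output
  obtain ⟨c, hc⟩ : ∃ c : ℝ, c * covarianceBilinDual μ T T = (1 + a) * covarianceBilinDual μ R R :=
    ⟨(1 + a) * covarianceBilinDual μ R R / covarianceBilinDual μ T T,
      div_mul_cancel₀ _ hTpos.ne'⟩
  have hTR : covarianceBilinDual μ T R = (1 + a) * covarianceBilinDual μ R R := by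
    rw [hTl, hvR, hzR]; ring
  have hTy : covarianceBilinDual μ T y = covarianceBilinDual μ T T := by
    have e : y = T + ((1 + a) * α + b) • w + ((1 + a) * α') • w₂ := by rw [hT]; module
    conv_lhs => rw [e]
    simp only [map_add, map_smul, hTl w, hTl w₂, hRw, hRw₂, hvw, hvw₂, h.noise_aux, hzw₂]
    simp
  -- The residual is a combination of x, w, u, z, w₂ uncorrelated with everything the decoder
  -- observes, so it is uncorrelated with the decision.
  have hRu : covarianceBilinDual μ (R - c • T) u₂ = 0 := by
    have hT' : ∀ l, covarianceBilinDual μ (R - c • T) l = covarianceBilinDual μ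
        ((1 - c * (1 + a) - c * (- a)) • x + (-α + c * (1 + a) * α + c * b) • w + (-c) • u +
          (-c) • z + (-α' + c * (1 + a) * α') • w₂) l := fun l => by
      simp only [map_add, map_sub, map_smul, add_apply, sub_apply, smul_apply, smul_eq_mul, hTl,
        hR, hv]
      ring
    rw [hT']
    refine hM _ _ _ _ _ ?_ ?_ ?_ <;> rw [← hT'] <;>
      simp only [map_sub, map_smul, sub_apply, smul_apply, smul_eq_mul]
    · rw [hTl, hRw, hvw, h.noise_aux]; ring
    · rw [hTl, hRw₂, hvw₂, hzw₂]; ring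
    · rw [hTy, hs R y, hyR, hc]; ring
  have hvu : N * covarianceBilinDual μ v u₂ =
      covarianceBilinDual μ v v * covarianceBilinDual μ z u₂ := by
    have e : (-(N * a)) • x + (-(N * b)) • w + N • u + (-covarianceBilinDual μ v v) • z +
        (0 : ℝ) • w₂ = N • v - covarianceBilinDual μ v v • z := by rw [hv]; module
    have h1 := hM (-(N * a)) (-(N * b)) N (-covarianceBilinDual μ v v) 0
    rw [e] at h1
    simp only [map_sub, map_smul, sub_apply, smul_apply, smul_eq_mul, hvw, hvw₂, hzw₂,
      h.noise_aux, hs v y, hs z y, hy, hs x v, hs w v, hs x z, hs w z, hzv, hvx, h.noise_state,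
      hs v z, h.noise_var] at h1
    linarith [h1 (by ring) (by ring) (by ring)]
  have hRR : covarianceBilinDual μ (R - c • T) (R - c • T) =
      covarianceBilinDual μ R R - c * ((1 + a) * covarianceBilinDual μ R R) := by
    simp only [map_sub, map_smul, sub_apply, smul_apply, smul_eq_mul, hs R T, hTR]
    linear_combination c * hc
  refine (optimalCost_le hQ hN hv0 hB (huu ▸ hP)).trans ?_
  refine (schemeCost_le_error (r := covarianceBilinDual μ (R - c • T) (R - c • T))
    hQ hN hv0 hB ?_).trans ?_
  · have e : covarianceBilinDual μ (R - c • T) (R - c • T) =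
        covarianceBilinDual μ R R * (covarianceBilinDual μ v v + N) /
          covarianceBilinDual μ T T := by
      rw [hRR, eq_div_iff hTpos.ne']
      linear_combination (-(1 + a) * covarianceBilinDual μ R R) * hc +
        covarianceBilinDual μ R R * hTT
    rw [e, div_le_div_iff₀ (by linarith) hTpos, hTT]
    have := mul_le_mul_of_nonneg_left hbound (show 0 ≤ covarianceBilinDual μ v v + N by linarith)
    linarith
  · refine estimation_error_ge (B := (covarianceBilinDual μ).toBilinForm) (b := b) (w := w)
      covarianceBilinDual_comm covarianceBilinDual_self_nonneg hN hx₁ hy hvx hvw h.noise_state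
      h.noise_aux hzv h.noise_var ?_ ?_ ?_ hRu ?_ hvu
    · refine Eq.trans (b := _) ?_ hRR.symm
      change covarianceBilinDual μ (R - c • T) x = _
      simp only [map_sub, map_smul, sub_apply, smul_apply, smul_eq_mul, hRx, hTl, hvx,
        h.noise_state]
      ring
    · change covarianceBilinDual μ (R - c • T) w = _
      simp only [map_sub, map_smul, sub_apply, smul_apply, smul_eq_mul, hTl, hRw, hvw,
        h.noise_aux]
      ring
    · change covarianceBilinDual μ (R - c • T) y = _
      simp only [map_sub, map_smul, sub_apply, smul_apply, smul_eq_mul, hs R y, hyR, hTy, hc]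
      ring
    · change N * covarianceBilinDual μ (R - c • T) v =
        covarianceBilinDual μ v v * covarianceBilinDual μ (R - c • T) z
      simp only [map_sub, map_smul, sub_apply, smul_apply, smul_eq_mul, hs R v, hvR, hTl, hzv,
        hs R z, hzR, hs v z, h.noise_var]
      ring

end Converse

/-! ### Conditional independence built into kernel compositions. -/

section Kernels

variable {α β γ δ : Type*} [MeasurableSpace α] [MeasurableSpace β] [MeasurableSpace γ]
  [MeasurableSpace δ]

lemma indepFun_map_iff_comp {μ : Measure α} {φ : α → β} (hφ : Measurable φ) {f : β → γ} {g : β → δ}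
    (hf : Measurable f) (hg : Measurable g) :
    IndepFun f g (μ.map φ) ↔ IndepFun (fun ω => f (φ ω)) (fun ω => g (φ ω)) μ := by
  simp only [indepFun_iff_measure_inter_preimage_eq_mul]
  refine forall₄_congr fun s t hs ht => ?_
  rw [Measure.map_apply hφ ((hf hs).inter (hg ht)), Measure.map_apply hφ (hf hs),
    Measure.map_apply hφ (hg ht)]
  rfl

/-- The outcome of a kernel with input `f` stays independent of whatever is independent of `f`. -/
lemma IndepFun.compProd_comap {ρ : Measure α} [IsProbabilityMeasure ρ] {κ : Kernel β γ}
    [IsMarkovKernel κ] {f : α → β} (hf : Measurable f) {g : α → δ} (hg : Measurable g)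
    (h : IndepFun g f ρ) :
    IndepFun (fun p : α × γ => g p.1) (fun p => (f p.1, p.2)) (ρ.compProd (κ.comap f hf)) := by
  rw [indepFun_iff_measure_inter_preimage_eq_mul]
  intro s t hs ht
  have hκ : Measurable (fun b => κ b (Prod.mk b ⁻¹' t)) := Kernel.measurable_kernel_prodMk_left ht
  have e1 : ∀ a, (κ.comap f hf a) (Prod.mk a ⁻¹' ((fun p : α × γ => g p.1) ⁻¹' s ∩
      (fun p : α × γ => (f p.1, p.2)) ⁻¹' t)) =
      s.indicator (fun _ => 1) (g a) * κ (f a) (Prod.mk (f a) ⁻¹' t) := by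
    intro a
    rw [Kernel.comap_apply]
    by_cases ha : g a ∈ s
    · rw [Set.indicator_of_mem ha, one_mul]
      congr 1
      ext c
      simp [ha]
    · rw [Set.indicator_of_notMem ha, zero_mul]
      have : Prod.mk a ⁻¹' ((fun p : α × γ => g p.1) ⁻¹' s ∩
          (fun p : α × γ => (f p.1, p.2)) ⁻¹' t) = ∅ := by
        ext c
        simp [ha]
      rw [this, measure_empty]
  have e2 : ∀ a, (κ.comap f hf a) (Prod.mk a ⁻¹' ((fun p : α × γ => (f p.1, p.2)) ⁻¹' t)) =
      κ (f a) (Prod.mk (f a) ⁻¹' t) := fun a => rfl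
  have e3 : ∀ a, (κ.comap f hf a) (Prod.mk a ⁻¹' ((fun p : α × γ => g p.1) ⁻¹' s)) =
      s.indicator (fun _ => 1) (g a) := by
    intro a
    by_cases ha : g a ∈ s <;> simp [Set.preimage_preimage, ha]
  have m1 : MeasurableSet ((fun p : α × γ => g p.1) ⁻¹' s) := (hg.comp measurable_fst) hs
  have m2 : MeasurableSet ((fun p : α × γ => (f p.1, p.2)) ⁻¹' t) :=
    ((hf.comp measurable_fst).prodMk measurable_snd) ht
  rw [Measure.compProd_apply (m1.inter m2), Measure.compProd_apply m1, Measure.compProd_apply m2]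
  simp_rw [e1, e2, e3]
  have hind : IndepFun (fun a => s.indicator (fun _ => (1 : ℝ≥0∞)) (g a))
      (fun a => κ (f a) (Prod.mk (f a) ⁻¹' t)) ρ :=
    h.comp (φ := s.indicator fun _ => (1 : ℝ≥0∞)) (ψ := fun b => κ b (Prod.mk b ⁻¹' t))
      (measurable_const.indicator hs) hκ
  exact lintegral_mul_eq_lintegral_mul_lintegral_of_indepFun
    ((measurable_const.indicator hs).comp hg) (hκ.comp hf) hind

/-- A product kernel can be sampled sequentially: the γ-component first, then the β-component from
the base point alone. This puts the product in the form required by `IndepFun.compProd_comap`. -/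
lemma compProd_prod_eq_map (ρ : Measure α) [IsProbabilityMeasure ρ] (κ : Kernel α β)
    (η : Kernel α γ) [IsMarkovKernel κ] [IsMarkovKernel η] :
    ρ.compProd (κ.prod η) = ((ρ.compProd η).compProd (κ.comap Prod.fst measurable_fst)).map
      (fun p => (p.1.1, (p.2, p.1.2))) := by
  refine Measure.ext_of_lintegral _ fun f hf => ?_
  have hm : Measurable fun p : α × γ =>
      ∫⁻ b, f (p.1, (b, p.2)) ∂(κ.comap Prod.fst measurable_fst p) :=
    Measurable.lintegral_kernel_prod_right'
      (f := fun q : (α × γ) × β => f (q.1.1, (q.2, q.1.2))) (by fun_prop)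
  rw [lintegral_map hf (by fun_prop), Measure.lintegral_compProd hf,
    Measure.lintegral_compProd (by fun_prop)]
  refine Eq.trans ?_ (Measure.lintegral_compProd hm).symm
  refine lintegral_congr fun a => ?_
  rw [Kernel.prod_apply, lintegral_prod_symm _ (by fun_prop)]
  rfl

/-- In the designs, the base point is (X₀, W₁), the first output W₂ and the second U₁. A residual of
U₁ independent of the base point remains independent after W₂ is adjoined. -/
lemma IndepFun.compProd_prod {ρ : Measure α} [IsProbabilityMeasure ρ] {κ : Kernel α β}
    {η : Kernel α γ} [IsMarkovKernel κ] [IsMarkovKernel η] {g : α × γ → δ} (hg : Measurable g)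
    (h : IndepFun (fun p : α × β × γ => g (p.1, p.2.2)) (fun p => p.1) (ρ.compProd (κ.prod η))) :
    IndepFun (fun p : α × β × γ => g (p.1, p.2.2)) (fun p => (p.1, p.2.1))
      (ρ.compProd (κ.prod η)) := by
  rw [compProd_prod_eq_map, indepFun_map_iff_comp (by fun_prop) (by fun_prop) (by fun_prop)] at h ⊢
  refine IndepFun.compProd_comap measurable_fst hg ?_
  have h2 := (indepFun_map_iff_comp (μ := (ρ.compProd η).compProd
    (κ.comap Prod.fst measurable_fst)) (φ := Prod.fst) (f := g) (g := Prod.fst)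
    measurable_fst hg measurable_fst).2 h
  rwa [← Measure.fst, Measure.fst_compProd] at h2

/-- Realises the channel with an explicit additive noise; the interim-state identity and the law and
independence of Y₁ − X₁ are read from it. -/
lemma compProd_channel_comap (ρ : Measure α) [IsProbabilityMeasure ρ] (N : ℝ≥0) {f : α → ℝ × ℝ}
    (hf : Measurable f) :
    ρ.compProd ((channel N).comap f hf) = (ρ.prod (gaussianReal 0 N)).map
      (fun p => (p.1, ((f p.1).1 + (f p.1).2, (f p.1).1 + (f p.1).2 + p.2))) := by
  refine Measure.ext_of_lintegral _ fun g hg => ?_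
  rw [lintegral_map hg (by fun_prop), Measure.lintegral_compProd hg,
    lintegral_prod _ (by fun_prop)]
  refine lintegral_congr fun a => ?_
  rw [Kernel.comap_apply, channel, Kernel.map_apply _ (by fun_prop),
    lintegral_map (by fun_prop) (by fun_prop), Kernel.prod_apply, Kernel.id_apply,
    Kernel.const_apply, lintegral_prod _ (by fun_prop), lintegral_dirac' _ (by fun_prop)]

lemma compProd_channel_interim (ρ : Measure α) [IsProbabilityMeasure ρ] (N : ℝ≥0)
    {f : α → ℝ × ℝ} (hf : Measurable f) :
    ∀ᵐ p ∂(ρ.compProd ((channel N).comap f hf)), p.2.1 = (f p.1).1 + (f p.1).2 := by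
  rw [compProd_channel_comap, ae_map_iff (by fun_prop)
    (measurableSet_eq_fun (by fun_prop) (by fun_prop))]
  exact ae_of_all _ fun _ => rfl

lemma compProd_channel_indepFun_noise (ρ : Measure α) [IsProbabilityMeasure ρ] (N : ℝ≥0)
    {f : α → ℝ × ℝ} (hf : Measurable f) :
    IndepFun (fun p => p.2.2 - p.2.1) (fun p => p.1) (ρ.compProd ((channel N).comap f hf)) := by
  rw [compProd_channel_comap, indepFun_map_iff_comp (by fun_prop) (by fun_prop) (by fun_prop)]
  have := (indepFun_prod (μ := ρ) (ν := gaussianReal 0 N) (X := id) (Y := id)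
    measurable_id measurable_id).symm
  simpa using this

lemma compProd_channel_map_noise (ρ : Measure α) [IsProbabilityMeasure ρ] (N : ℝ≥0)
    {f : α → ℝ × ℝ} (hf : Measurable f) :
    (ρ.compProd ((channel N).comap f hf)).map (fun p => p.2.2 - p.2.1) = gaussianReal 0 N := by
  rw [compProd_channel_comap, Measure.map_map (by fun_prop) (by fun_prop)]
  have e : ((fun p : α × ℝ × ℝ => p.2.2 - p.2.1) ∘ fun p : α × ℝ =>
      (p.1, ((f p.1).1 + (f p.1).2, (f p.1).1 + (f p.1).2 + p.2))) = Prod.snd := by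
    funext p; simp
  rw [e, ← Measure.snd, Measure.snd_prod]

end Kernels

/-! ### Independence, almost sure equality and moments in terms of covariance. -/

section GaussianCovariance

variable {F : Type*} [NormedAddCommGroup F] [NormedSpace ℝ F] [CompleteSpace F]
  [SecondCountableTopology F] [MeasurableSpace F] [BorelSpace F] {μ : Measure F} [IsGaussian μ]

lemma covarianceBilinDual_eq_zero_of_indepFun {L L' : F →L[ℝ] ℝ} (h : IndepFun L L' μ) :
    covarianceBilinDual μ L L' = 0 := by
  rw [covarianceBilinDual_eq_cov]
  exact h.covariance_eq_zero (IsGaussian.memLp_dual μ L 2 (by simp))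
    (IsGaussian.memLp_dual μ L' 2 (by simp))

lemma covarianceBilinDual_self_of_map_eq {L : F →L[ℝ] ℝ} {m : ℝ} {v : ℝ≥0}
    (h : μ.map L = gaussianReal m v) : covarianceBilinDual μ L L = v := by
  rw [covarianceBilinDual_self_eq_variance IsGaussian.memLp_two_id, ← variance_id_map (by fun_prop),
    h, variance_id_gaussianReal]

/-- The difference has zero variance, so it is a null vector of the form. This handles X₁ = X₀ + U₁,
which holds only almost surely between coordinates. -/
lemma covarianceBilinDual_congr_ae {L L' : F →L[ℝ] ℝ} (h : ∀ᵐ ω ∂μ, L ω = L' ω)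
    (M : F →L[ℝ] ℝ) : covarianceBilinDual μ L M = covarianceBilinDual μ L' M := by
  have h0 : covarianceBilinDual μ (L - L') (L - L') = 0 := by
    rw [covarianceBilinDual_self_eq_variance IsGaussian.memLp_two_id,
      variance_congr (Y := 0) (by filter_upwards [h] with ω hω; simp [hω]), variance_zero]
  have := bilin_eq_zero_of_self_eq_zero (B := (covarianceBilinDual μ).toBilinForm)
    covarianceBilinDual_comm covarianceBilinDual_self_nonneg h0 M
  replace this : covarianceBilinDual μ M (L - L') = 0 := this
  rw [covarianceBilinDual_comm, map_sub, sub_apply] at this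
  linarith

lemma indepFun_pair (R g g' : F →L[ℝ] ℝ) (h : covarianceBilinDual μ R g = 0)
    (h' : covarianceBilinDual μ R g' = 0) : IndepFun R (fun ω => (g ω, g' ω)) μ :=
  (indepFun_of_covarianceBilinDual_eq_zero (g.prod g') R
    (covarianceBilinDual_comp_prod R g g' (covarianceBilinDual_comp_real R g h)
      (covarianceBilinDual_comp_real R g' h'))).symm

lemma indepFun_triple (R g g' g'' : F →L[ℝ] ℝ) (h : covarianceBilinDual μ R g = 0)
    (h' : covarianceBilinDual μ R g' = 0) (h'' : covarianceBilinDual μ R g'' = 0) :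
    IndepFun R (fun ω => (g ω, g' ω, g'' ω)) μ :=
  (indepFun_of_covarianceBilinDual_eq_zero (g.prod (g'.prod g'')) R
    (covarianceBilinDual_comp_prod R g (g'.prod g'') (covarianceBilinDual_comp_real R g h)
      (covarianceBilinDual_comp_prod R g' g'' (covarianceBilinDual_comp_real R g' h')
        (covarianceBilinDual_comp_real R g'' h'')))).symm

/-- Covers non-centered families: variance is bounded by power on the constraint side and by the
error on the cost side. -/
lemma covarianceBilinDual_self_le_integral_sq (L : F →L[ℝ] ℝ) :
    covarianceBilinDual μ L L ≤ ∫ ω, L ω ^ 2 ∂μ := by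
  rw [covarianceBilinDual_self_eq_variance IsGaussian.memLp_two_id]
  exact variance_le_expectation_sq (by fun_prop)

lemma integral_sq_eq_covarianceBilinDual_self (L : F →L[ℝ] ℝ) (h : ∫ ω, ω ∂μ = 0) :
    ∫ ω, L ω ^ 2 ∂μ = covarianceBilinDual μ L L := by
  rw [covarianceBilinDual_self_eq_variance IsGaussian.memLp_two_id,
    variance_of_integral_eq_zero (by fun_prop)]
  exact (L.integral_comp_comm (φ := fun ω => ω) IsGaussian.integrable_id).trans
    (by rw [h, map_zero])

end GaussianCovariance

/-! ### Passing to marginals of a composition. -/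

section Transfer

variable {α β γ δ : Type*} [MeasurableSpace α] [MeasurableSpace β] [MeasurableSpace γ]
  [MeasurableSpace δ]

lemma indepFun_compProd_fst (ρ : Measure α) [IsProbabilityMeasure ρ] (κ : Kernel α β)
    [IsMarkovKernel κ] {f : α → γ} {g : α → δ} (hf : Measurable f) (hg : Measurable g) :
    IndepFun (fun p => f p.1) (fun p => g p.1) (ρ.compProd κ) ↔ IndepFun f g ρ := by
  rw [← indepFun_map_iff_comp measurable_fst hf hg, ← Measure.fst, Measure.fst_compProd]

lemma map_compProd_fst (ρ : Measure α) [IsProbabilityMeasure ρ] (κ : Kernel α β)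
    [IsMarkovKernel κ] {f : α → γ} (hf : Measurable f) :
    (ρ.compProd κ).map (fun p => f p.1) = ρ.map f := by
  conv_rhs => rw [← Measure.fst_compProd ρ κ, Measure.fst, Measure.map_map hf measurable_fst]
  rfl

end Transfer

/-! ### Second-order relations for designs with two auxiliary variables. -/

namespace Design

/-- The coordinate map of the initial state `X₀`. -/
def x0L : Outcome →L[ℝ] ℝ := (ContinuousLinearMap.fst ℝ ℝ ℝ).comp
  ((ContinuousLinearMap.fst ℝ (ℝ × ℝ) (ℝ × ℝ)).comp
    ((ContinuousLinearMap.fst ℝ ((ℝ × ℝ) × (ℝ × ℝ)) (ℝ × ℝ)).comp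
      (ContinuousLinearMap.fst ℝ (((ℝ × ℝ) × (ℝ × ℝ)) × (ℝ × ℝ)) ℝ)))

/-- The coordinate map of the first auxiliary variable `W₁`. -/
def w1L : Outcome →L[ℝ] ℝ := (ContinuousLinearMap.snd ℝ ℝ ℝ).comp
  ((ContinuousLinearMap.fst ℝ (ℝ × ℝ) (ℝ × ℝ)).comp
    ((ContinuousLinearMap.fst ℝ ((ℝ × ℝ) × (ℝ × ℝ)) (ℝ × ℝ)).comp
      (ContinuousLinearMap.fst ℝ (((ℝ × ℝ) × (ℝ × ℝ)) × (ℝ × ℝ)) ℝ)))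

/-- The coordinate map of the second auxiliary variable `W₂`. -/
def w2L : Outcome →L[ℝ] ℝ := (ContinuousLinearMap.fst ℝ ℝ ℝ).comp
  ((ContinuousLinearMap.snd ℝ (ℝ × ℝ) (ℝ × ℝ)).comp
    ((ContinuousLinearMap.fst ℝ ((ℝ × ℝ) × (ℝ × ℝ)) (ℝ × ℝ)).comp
      (ContinuousLinearMap.fst ℝ (((ℝ × ℝ) × (ℝ × ℝ)) × (ℝ × ℝ)) ℝ)))

/-- The coordinate map of the first action `U₁`. -/
def u1L : Outcome →L[ℝ] ℝ := (ContinuousLinearMap.snd ℝ ℝ ℝ).comp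
  ((ContinuousLinearMap.snd ℝ (ℝ × ℝ) (ℝ × ℝ)).comp
    ((ContinuousLinearMap.fst ℝ ((ℝ × ℝ) × (ℝ × ℝ)) (ℝ × ℝ)).comp
      (ContinuousLinearMap.fst ℝ (((ℝ × ℝ) × (ℝ × ℝ)) × (ℝ × ℝ)) ℝ)))

/-- The coordinate map of the controlled state `X₁`. -/
def x1L : Outcome →L[ℝ] ℝ := (ContinuousLinearMap.fst ℝ ℝ ℝ).comp
  ((ContinuousLinearMap.snd ℝ ((ℝ × ℝ) × (ℝ × ℝ)) (ℝ × ℝ)).comp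
    (ContinuousLinearMap.fst ℝ (((ℝ × ℝ) × (ℝ × ℝ)) × (ℝ × ℝ)) ℝ))

/-- The coordinate map of the channel output `Y₁`. -/
def y1L : Outcome →L[ℝ] ℝ := (ContinuousLinearMap.snd ℝ ℝ ℝ).comp
  ((ContinuousLinearMap.snd ℝ ((ℝ × ℝ) × (ℝ × ℝ)) (ℝ × ℝ)).comp
    (ContinuousLinearMap.fst ℝ (((ℝ × ℝ) × (ℝ × ℝ)) × (ℝ × ℝ)) ℝ))

/-- The coordinate map of the second action `U₂`. -/
def u2L : Outcome →L[ℝ] ℝ := ContinuousLinearMap.snd ℝ (((ℝ × ℝ) × (ℝ × ℝ)) × (ℝ × ℝ)) ℝ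

variable (Q N : ℝ≥0) (d : Design)

/-- The law of `(X₀, W₁, W₂, U₁)`. -/
noncomputable def inputLaw : Measure ((ℝ × ℝ) × (ℝ × ℝ)) :=
  ((gaussianReal 0 Q).prod d.lawW1).compProd (d.kerW2.prod d.kerU1)

/-- The law of `(X₀, W₁, W₂, U₁, X₁, Y₁)`. -/
noncomputable def outputLaw : Measure (((ℝ × ℝ) × (ℝ × ℝ)) × (ℝ × ℝ)) :=
  (d.inputLaw Q).compProd ((channel N).comap (fun p => (p.1.1, p.2.2)) (by fun_prop))

instance : IsProbabilityMeasure (d.inputLaw Q) := by unfold inputLaw; infer_instance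

instance : IsProbabilityMeasure (d.outputLaw Q N) := by unfold outputLaw; infer_instance

lemma law_eq : d.law Q N = (d.outputLaw Q N).compProd
    (d.kerU2.comap (fun p => (p.1.1.2, p.1.2.1, p.2.2)) (by fun_prop)) := rfl

variable {Q N d}

lemma indepFun_outputLaw {β γ : Type*} [MeasurableSpace β] [MeasurableSpace γ]
    {f : ((ℝ × ℝ) × (ℝ × ℝ)) × (ℝ × ℝ) → β} {g : ((ℝ × ℝ) × (ℝ × ℝ)) × (ℝ × ℝ) → γ}
    (hf : Measurable f) (hg : Measurable g) :
    IndepFun (fun ω : Outcome => f ω.1) (fun ω => g ω.1) (d.law Q N) ↔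
      IndepFun f g (d.outputLaw Q N) := by
  rw [law_eq, indepFun_compProd_fst _ _ hf hg]

lemma indepFun_inputLaw {β γ : Type*} [MeasurableSpace β] [MeasurableSpace γ]
    {f : (ℝ × ℝ) × (ℝ × ℝ) → β} {g : (ℝ × ℝ) × (ℝ × ℝ) → γ}
    (hf : Measurable f) (hg : Measurable g) :
    IndepFun (fun ω : Outcome => f ω.1.1) (fun ω => g ω.1.1) (d.law Q N) ↔
      IndepFun f g (d.inputLaw Q) := by
  rw [indepFun_outputLaw (f := fun p => f p.1) (g := fun p => g p.1) (by fun_prop) (by fun_prop),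
    outputLaw, indepFun_compProd_fst _ _ hf hg]

lemma indepFun_noise : IndepFun (fun ω : Outcome => ω.1.2.2 - ω.1.2.1) (fun ω => ω.1.1)
    (d.law Q N) :=
  (indepFun_outputLaw (f := fun p => p.2.2 - p.2.1) (g := fun p => p.1)
    (by fun_prop) (by fun_prop)).2 (compProd_channel_indepFun_noise _ _ _)

variable [IsGaussian (d.law Q N)]

lemma covarianceBilinDual_noise {l : Outcome →L[ℝ] ℝ} {f : (ℝ × ℝ) × (ℝ × ℝ) → ℝ}
    (hf : Measurable f) (hl : ⇑l = fun ω => f ω.1.1) :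
    covarianceBilinDual (d.law Q N) (y1L - x1L) l = 0 := by
  refine covarianceBilinDual_eq_zero_of_indepFun ?_
  rw [hl]
  exact indepFun_noise.comp measurable_id hf

lemma isChannelModel :
    IsChannelModel (d.law Q N) Q N x0L w1L u1L (y1L - x1L) x1L y1L where
  state_var := by
    refine covarianceBilinDual_self_of_map_eq (m := 0) ?_
    have h1 := map_compProd_fst (d.outputLaw Q N)
      (d.kerU2.comap (fun p => (p.1.1.2, p.1.2.1, p.2.2)) (by fun_prop))
      (f := fun p => p.1.1.1) (by fun_prop)
    have h2 := map_compProd_fst (d.inputLaw Q)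
      ((channel N).comap (fun p => (p.1.1, p.2.2)) (by fun_prop))
      (f := fun p => p.1.1) (by fun_prop)
    have h3 := map_compProd_fst ((gaussianReal 0 Q).prod d.lawW1) (d.kerW2.prod d.kerU1)
      (f := fun p => p.1) (by fun_prop)
    refine h1.trans (h2.trans (h3.trans ?_))
    exact Measure.fst_prod
  state_aux := by
    refine covarianceBilinDual_eq_zero_of_indepFun ?_
    refine (indepFun_inputLaw (f := fun p => p.1.1) (g := fun p => p.1.2)
      (by fun_prop) (by fun_prop)).2 ?_
    exact (indepFun_compProd_fst _ _ measurable_fst measurable_snd).2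
      (indepFun_prod (X := id) (Y := id) measurable_id measurable_id)
  noise_var := covarianceBilinDual_self_of_map_eq (m := 0) <|
    (map_compProd_fst (d.outputLaw Q N)
      (d.kerU2.comap (fun p => (p.1.1.2, p.1.2.1, p.2.2)) (by fun_prop))
      (f := fun p => p.2.2 - p.2.1) (by fun_prop)).trans
      (compProd_channel_map_noise _ _ _)
  noise_state := covarianceBilinDual_noise (f := fun p => p.1.1) (by fun_prop) rfl
  noise_aux := covarianceBilinDual_noise (f := fun p => p.1.2) (by fun_prop) rfl
  noise_action := covarianceBilinDual_noise (f := fun p => p.2.2) (by fun_prop) rfl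
  interim l := by
    rw [← add_apply, ← map_add]
    refine covarianceBilinDual_congr_ae ?_ l
    have h := compProd_channel_interim (d.inputLaw Q) N
      (f := fun p => (p.1.1, p.2.2)) (by fun_prop)
    have h2 : ∀ᵐ p ∂(d.law Q N).map Prod.fst, p.2.1 = p.1.1.1 + p.1.2.2 := by
      rw [law_eq, ← Measure.fst, Measure.fst_compProd]; exact h
    exact ae_of_ae_map measurable_fst.aemeasurable h2
  output l := by simp

/-- Being uncorrelated with X₀ and W₁ means independence of the pair; W₂ is drawn from that pair
without access to U₁. -/
lemma covarianceBilinDual_w2L (α β γ : ℝ)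
    (hx : covarianceBilinDual (d.law Q N) (α • x0L + β • w1L + γ • u1L) x0L = 0)
    (hw : covarianceBilinDual (d.law Q N) (α • x0L + β • w1L + γ • u1L) w1L = 0) :
    covarianceBilinDual (d.law Q N) (α • x0L + β • w1L + γ • u1L) w2L = 0 := by
  have h1 : IndepFun (fun p : (ℝ × ℝ) × (ℝ × ℝ) => α * p.1.1 + β * p.1.2 + γ * p.2.2)
      (fun p => p.1) (d.inputLaw Q) :=
    (indepFun_inputLaw (by fun_prop) (by fun_prop)).1 (indepFun_pair _ x0L w1L hx hw)
  have h2 := IndepFun.compProd_prod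
    (g := fun p : (ℝ × ℝ) × ℝ => α * p.1.1 + β * p.1.2 + γ * p.2) (by fun_prop) h1
  have h3 := (indepFun_inputLaw (N := N) (by fun_prop) (by fun_prop)).2 h2
  exact covarianceBilinDual_eq_zero_of_indepFun
    (h3.comp measurable_id (measurable_snd))

/-- Gaussianity upgrades uncorrelated to independent of (W₁, W₂, Y₁), and the kernel producing U₂
sees nothing else. -/
lemma covarianceBilinDual_u2L (α β γ δ ε : ℝ)
    (hw : covarianceBilinDual (d.law Q N)
      (α • x0L + β • w1L + γ • u1L + δ • (y1L - x1L) + ε • w2L) w1L = 0)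
    (hw₂ : covarianceBilinDual (d.law Q N)
      (α • x0L + β • w1L + γ • u1L + δ • (y1L - x1L) + ε • w2L) w2L = 0)
    (hy : covarianceBilinDual (d.law Q N)
      (α • x0L + β • w1L + γ • u1L + δ • (y1L - x1L) + ε • w2L) y1L = 0) :
    covarianceBilinDual (d.law Q N)
      (α • x0L + β • w1L + γ • u1L + δ • (y1L - x1L) + ε • w2L) u2L = 0 := by
  have h1 : IndepFun (fun p : ((ℝ × ℝ) × (ℝ × ℝ)) × (ℝ × ℝ) =>
      α * p.1.1.1 + β * p.1.1.2 + γ * p.1.2.2 + δ * (p.2.2 - p.2.1) + ε * p.1.2.1)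
      (fun p => (p.1.1.2, p.1.2.1, p.2.2)) (d.outputLaw Q N) :=
    (indepFun_outputLaw (by fun_prop) (by fun_prop)).1 (indepFun_triple _ w1L w2L y1L hw hw₂ hy)
  have h2 := IndepFun.compProd_comap (κ := d.kerU2) (by fun_prop) (by fun_prop) h1
  exact covarianceBilinDual_eq_zero_of_indepFun (h2.comp measurable_id measurable_snd)

end Design

lemma Design.optimalCost_le_cost_of_mem_domain {Q N : ℝ≥0} (hQ : 0 < Q) (hN : 0 < N) {P : ℝ}
    {d : Design} (hd : d ∈ domain Q N P) : optimalCost Q N P ≤ d.cost Q N := by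
  obtain ⟨hG, hP, hI⟩ := hd
  have h := Design.isChannelModel (Q := Q) (N := N) (d := d)
  refine (h.optimalCost_le_of_auxiliary (w₂ := Design.w2L) (u₂ := Design.u2L) (by simpa using hQ)
    (by simpa using hN) ((covarianceBilinDual_self_le_integral_sq _).trans hP.le)
    (Design.covarianceBilinDual_noise (f := fun p => p.2.1) (by fun_prop) rfl)
    Design.covarianceBilinDual_w2L Design.covarianceBilinDual_u2L hI).trans
    (covarianceBilinDual_self_le_integral_sq _)

/-- Although U₂ may depend on W₂, a combination uncorrelated with X₀, W₁, Y₁ is automatically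
uncorrelated with W₂, so the bound without W₂ applies. -/
lemma Design.optimalCost_le_cost_of_mem_feedbackDomain {Q N : ℝ≥0} (hQ : 0 < Q) (hN : 0 < N)
    {P : ℝ} {d : Design} (hd : d ∈ feedbackDomain Q N P) : optimalCost Q N P ≤ d.cost Q N := by
  obtain ⟨hG, hP, hI⟩ := hd
  have h := Design.isChannelModel (Q := Q) (N := N) (d := d)
  refine (h.optimalCost_le_of_feedback (u₂ := Design.u2L) (by simpa using hQ)
    (by simpa using hN) ((covarianceBilinDual_self_le_integral_sq _).trans hP.le)
    (fun α β γ δ hx hw hy => ?_) hI).trans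
    (covarianceBilinDual_self_le_integral_sq _)
  have hzw₂ : covarianceBilinDual (d.law Q N) (Design.y1L - Design.x1L) Design.w2L = 0 :=
    Design.covarianceBilinDual_noise (f := fun p => p.2.1) (by fun_prop) rfl
  -- The noise is uncorrelated with X₀ and W₁, so its term drops out and a combination of X₀, W₁, U₁
  -- remains.
  have hw₂ := Design.covarianceBilinDual_w2L (Q := Q) (N := N) (d := d) α β γ
    (by rw [map_add, add_apply, map_smul _ δ, smul_apply, h.noise_state, smul_zero, add_zero] at hx
        exact hx)
    (by rw [map_add, add_apply, map_smul _ δ, smul_apply, h.noise_aux, smul_zero, add_zero] at hw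
        exact hw)
  have := Design.covarianceBilinDual_u2L (Q := Q) (N := N) (d := d) α β γ δ 0
  simp only [zero_smul, add_zero] at this
  refine this hw ?_ hy
  rw [map_add, add_apply, hw₂, map_smul, smul_apply, hzw₂, smul_zero, add_zero]

/-! ### Second-order relations for direct designs. -/

namespace DirectDesign

/-- The coordinate map of the initial state `X₀`. -/
def x0L : DirectDesign.Outcome →L[ℝ] ℝ := (ContinuousLinearMap.fst ℝ ℝ ℝ).comp
  ((ContinuousLinearMap.fst ℝ (ℝ × ℝ) ℝ).comp
    ((ContinuousLinearMap.fst ℝ ((ℝ × ℝ) × ℝ) (ℝ × ℝ)).comp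
      (ContinuousLinearMap.fst ℝ (((ℝ × ℝ) × ℝ) × (ℝ × ℝ)) ℝ)))

/-- The coordinate map of the first auxiliary variable `W₁`. -/
def w1L : DirectDesign.Outcome →L[ℝ] ℝ := (ContinuousLinearMap.snd ℝ ℝ ℝ).comp
  ((ContinuousLinearMap.fst ℝ (ℝ × ℝ) ℝ).comp
    ((ContinuousLinearMap.fst ℝ ((ℝ × ℝ) × ℝ) (ℝ × ℝ)).comp
      (ContinuousLinearMap.fst ℝ (((ℝ × ℝ) × ℝ) × (ℝ × ℝ)) ℝ)))

/-- The coordinate map of the first action `U₁`. -/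
def u1L : DirectDesign.Outcome →L[ℝ] ℝ := (ContinuousLinearMap.snd ℝ (ℝ × ℝ) ℝ).comp
  ((ContinuousLinearMap.fst ℝ ((ℝ × ℝ) × ℝ) (ℝ × ℝ)).comp
    (ContinuousLinearMap.fst ℝ (((ℝ × ℝ) × ℝ) × (ℝ × ℝ)) ℝ))

/-- The coordinate map of the controlled state `X₁`. -/
def x1L : DirectDesign.Outcome →L[ℝ] ℝ := (ContinuousLinearMap.fst ℝ ℝ ℝ).comp
  ((ContinuousLinearMap.snd ℝ ((ℝ × ℝ) × ℝ) (ℝ × ℝ)).comp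
    (ContinuousLinearMap.fst ℝ (((ℝ × ℝ) × ℝ) × (ℝ × ℝ)) ℝ))

/-- The coordinate map of the channel output `Y₁`. -/
def y1L : DirectDesign.Outcome →L[ℝ] ℝ := (ContinuousLinearMap.snd ℝ ℝ ℝ).comp
  ((ContinuousLinearMap.snd ℝ ((ℝ × ℝ) × ℝ) (ℝ × ℝ)).comp
    (ContinuousLinearMap.fst ℝ (((ℝ × ℝ) × ℝ) × (ℝ × ℝ)) ℝ))

/-- The coordinate map of the second action `U₂`. -/
def u2L : DirectDesign.Outcome →L[ℝ] ℝ :=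
  ContinuousLinearMap.snd ℝ (((ℝ × ℝ) × ℝ) × (ℝ × ℝ)) ℝ

variable (Q N : ℝ≥0) (d : DirectDesign)

/-- The law of `(X₀, W₁, U₁)`. -/
noncomputable def inputLaw : Measure ((ℝ × ℝ) × ℝ) :=
  ((gaussianReal 0 Q).prod d.lawW1).compProd d.kerU1

/-- The law of `(X₀, W₁, U₁, X₁, Y₁)`. -/
noncomputable def outputLaw : Measure (((ℝ × ℝ) × ℝ) × (ℝ × ℝ)) :=
  (d.inputLaw Q).compProd ((channel N).comap (fun p => (p.1.1, p.2)) (by fun_prop))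

instance : IsProbabilityMeasure (d.inputLaw Q) := by unfold inputLaw; infer_instance

instance : IsProbabilityMeasure (d.outputLaw Q N) := by unfold outputLaw; infer_instance

lemma law_eq : d.law Q N = (d.outputLaw Q N).compProd
    (d.kerU2.comap (fun p => (p.1.1.1, p.1.1.2, p.2.2)) (by fun_prop)) := rfl

variable {Q N d}

lemma indepFun_outputLaw {β γ : Type*} [MeasurableSpace β] [MeasurableSpace γ]
    {f : ((ℝ × ℝ) × ℝ) × (ℝ × ℝ) → β} {g : ((ℝ × ℝ) × ℝ) × (ℝ × ℝ) → γ}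
    (hf : Measurable f) (hg : Measurable g) :
    IndepFun (fun ω : DirectDesign.Outcome => f ω.1) (fun ω => g ω.1) (d.law Q N) ↔
      IndepFun f g (d.outputLaw Q N) := by
  rw [law_eq, indepFun_compProd_fst _ _ hf hg]

lemma indepFun_noise : IndepFun (fun ω : DirectDesign.Outcome => ω.1.2.2 - ω.1.2.1)
    (fun ω => ω.1.1) (d.law Q N) :=
  (indepFun_outputLaw (f := fun p => p.2.2 - p.2.1) (g := fun p => p.1)
    (by fun_prop) (by fun_prop)).2 (compProd_channel_indepFun_noise _ _ _)

variable [IsGaussian (d.law Q N)]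

lemma covarianceBilinDual_noise {l : DirectDesign.Outcome →L[ℝ] ℝ} {f : (ℝ × ℝ) × ℝ → ℝ}
    (hf : Measurable f) (hl : ⇑l = fun ω => f ω.1.1) :
    covarianceBilinDual (d.law Q N) (y1L - x1L) l = 0 := by
  refine covarianceBilinDual_eq_zero_of_indepFun ?_
  rw [hl]
  exact indepFun_noise.comp measurable_id hf

lemma isChannelModel :
    IsChannelModel (d.law Q N) Q N x0L w1L u1L (y1L - x1L) x1L y1L where
  state_var := by
    refine covarianceBilinDual_self_of_map_eq (m := 0) ?_
    have h1 := map_compProd_fst (d.outputLaw Q N)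
      (d.kerU2.comap (fun p => (p.1.1.1, p.1.1.2, p.2.2)) (by fun_prop))
      (f := fun p => p.1.1.1) (by fun_prop)
    have h2 := map_compProd_fst (d.inputLaw Q)
      ((channel N).comap (fun p => (p.1.1, p.2)) (by fun_prop))
      (f := fun p => p.1.1) (by fun_prop)
    have h3 := map_compProd_fst ((gaussianReal 0 Q).prod d.lawW1) d.kerU1
      (f := fun p => p.1) (by fun_prop)
    refine h1.trans (h2.trans (h3.trans ?_))
    exact Measure.fst_prod
  state_aux := by
    refine covarianceBilinDual_eq_zero_of_indepFun ?_
    refine (indepFun_outputLaw (f := fun p => p.1.1.1) (g := fun p => p.1.1.2)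
      (by fun_prop) (by fun_prop)).2 ?_
    refine (indepFun_compProd_fst (d.inputLaw Q) _ (f := fun p => p.1.1) (g := fun p => p.1.2)
      (by fun_prop) (by fun_prop)).2 ?_
    exact (indepFun_compProd_fst _ _ measurable_fst measurable_snd).2
      (indepFun_prod (X := id) (Y := id) measurable_id measurable_id)
  noise_var := covarianceBilinDual_self_of_map_eq (m := 0) <|
    (map_compProd_fst (d.outputLaw Q N)
      (d.kerU2.comap (fun p => (p.1.1.1, p.1.1.2, p.2.2)) (by fun_prop))
      (f := fun p => p.2.2 - p.2.1) (by fun_prop)).trans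
      (compProd_channel_map_noise _ _ _)
  noise_state := covarianceBilinDual_noise (f := fun p => p.1.1) (by fun_prop) rfl
  noise_aux := covarianceBilinDual_noise (f := fun p => p.1.2) (by fun_prop) rfl
  noise_action := covarianceBilinDual_noise (f := fun p => p.2) (by fun_prop) rfl
  interim l := by
    rw [← add_apply, ← map_add]
    refine covarianceBilinDual_congr_ae ?_ l
    have h := compProd_channel_interim (d.inputLaw Q) N
      (f := fun p => (p.1.1, p.2)) (by fun_prop)
    have h2 : ∀ᵐ p ∂(d.law Q N).map Prod.fst, p.2.1 = p.1.1.1 + p.1.2 := by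
      rw [law_eq, ← Measure.fst, Measure.fst_compProd]; exact h
    exact ae_of_ae_map measurable_fst.aemeasurable h2
  output l := by simp

lemma covarianceBilinDual_u2L (α β γ δ : ℝ)
    (hx : covarianceBilinDual (d.law Q N)
      (α • x0L + β • w1L + γ • u1L + δ • (y1L - x1L)) x0L = 0)
    (hw : covarianceBilinDual (d.law Q N)
      (α • x0L + β • w1L + γ • u1L + δ • (y1L - x1L)) w1L = 0)
    (hy : covarianceBilinDual (d.law Q N)
      (α • x0L + β • w1L + γ • u1L + δ • (y1L - x1L)) y1L = 0) :
    covarianceBilinDual (d.law Q N)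
      (α • x0L + β • w1L + γ • u1L + δ • (y1L - x1L)) u2L = 0 := by
  have h1 : IndepFun (fun p : ((ℝ × ℝ) × ℝ) × (ℝ × ℝ) =>
      α * p.1.1.1 + β * p.1.1.2 + γ * p.1.2 + δ * (p.2.2 - p.2.1))
      (fun p => (p.1.1.1, p.1.1.2, p.2.2)) (d.outputLaw Q N) :=
    (indepFun_outputLaw (by fun_prop) (by fun_prop)).1 (indepFun_triple _ x0L w1L y1L hx hw hy)
  have h2 := IndepFun.compProd_comap (κ := d.kerU2) (by fun_prop) (by fun_prop) h1
  exact covarianceBilinDual_eq_zero_of_indepFun (h2.comp measurable_id measurable_snd)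

lemma optimalCost_le_cost_of_mem_domain {Q N : ℝ≥0} (hQ : 0 < Q) (hN : 0 < N)
    {P : ℝ} {d : DirectDesign} (hd : d ∈ DirectDesign.domain Q N P) :
    optimalCost Q N P ≤ d.cost Q N := by
  obtain ⟨hG, hP, hI⟩ := hd
  exact (isChannelModel.optimalCost_le_of_feedback (u₂ := u2L) (by simpa using hQ)
    (by simpa using hN) ((covarianceBilinDual_self_le_integral_sq _).trans hP.le)
    covarianceBilinDual_u2L hI).trans (covarianceBilinDual_self_le_integral_sq _)

end DirectDesign

/-! ### The linear scheme and its information constraints. -/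

section Achievability

variable {F : Type*} [NormedAddCommGroup F] [NormedSpace ℝ F] [MeasurableSpace F] [BorelSpace F]

/-- Uncorrelated sources `x, w, t, z` with variances `Q, 1, N Q, N`. -/
structure IsSource (μ : Measure F) (Q N : ℝ) (x w t z : F →L[ℝ] ℝ) : Prop where
  centered : ∫ ω, ω ∂μ = 0
  xx : covarianceBilinDual μ x x = Q
  ww : covarianceBilinDual μ w w = 1
  tt : covarianceBilinDual μ t t = N * Q
  zz : covarianceBilinDual μ z z = N
  xw : covarianceBilinDual μ x w = 0
  xt : covarianceBilinDual μ x t = 0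
  xz : covarianceBilinDual μ x z = 0
  wt : covarianceBilinDual μ w t = 0
  wz : covarianceBilinDual μ w z = 0
  tz : covarianceBilinDual μ t z = 0

variable {μ : Measure F} {Q N : ℝ} {x w t z : F →L[ℝ] ℝ}

lemma IsSource.covarianceBilinDual_eq (h : IsSource μ Q N x w t z) (a b c d a' b' c' d' : ℝ) :
    covarianceBilinDual μ (a • x + b • w + c • t + d • z) (a' • x + b' • w + c' • t + d' • z) =
      a * a' * Q + b * b' + c * c' * (N * Q) + d * d' * N := by
  have hs : ∀ l l', covarianceBilinDual μ l l' = covarianceBilinDual μ l' l :=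
    covarianceBilinDual_comm
  simp only [map_add, map_smul, add_apply, smul_apply, smul_eq_mul, hs w x, hs t x, hs z x,
    hs t w, hs z w, hs z t, h.xx, h.ww, h.tt, h.zz, h.xw, h.xt, h.xz, h.wt, h.wz, h.tz]
  ring

lemma IsSource.covarianceBilinDual_of_eq (h : IsSource μ Q N x w t z) {l l' : F →L[ℝ] ℝ}
    {a b c d a' b' c' d' : ℝ} (hl : l = a • x + b • w + c • t + d • z)
    (hl' : l' = a' • x + b' • w + c' • t + d' • z) :
    covarianceBilinDual μ l l' = a * a' * Q + b * b' + c * c' * (N * Q) + d * d' * N := by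
  rw [hl, hl', h.covarianceBilinDual_eq]

/-- The first action of the linear scheme. -/
def schemeU1 (a b : ℝ) (x w : F →L[ℝ] ℝ) : F →L[ℝ] ℝ := a • x + b • w

/-- The auxiliary variable of the linear scheme. -/
def schemeW2 (b : ℝ) (x t : F →L[ℝ] ℝ) : F →L[ℝ] ℝ := b • x + t

/-- The channel output of the linear scheme. -/
def schemeY (a b : ℝ) (x w z : F →L[ℝ] ℝ) : F →L[ℝ] ℝ := x + schemeU1 a b x w + z

/-- The variance of the channel output of the linear scheme. -/
noncomputable def schemeVar (Q N a b : ℝ) : ℝ := N + b ^ 2 + (1 + a) ^ 2 * Q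

/-- The second action of the linear scheme: the best estimate of `(1 + a) x + b w` from `w`, `w₂`
and `y`. -/
noncomputable def schemeU2 (Q N a b : ℝ) (x w t z : F →L[ℝ] ℝ) : F →L[ℝ] ℝ :=
  b • w + ((1 + a) * b / schemeVar Q N a b) • schemeW2 b x t +
    ((1 + a) ^ 2 * Q / schemeVar Q N a b) • (schemeY a b x w z - b • w)

variable {a b : ℝ}

lemma schemeVar_pos (hQ : 0 < Q) (hN : 0 < N) : 0 < schemeVar Q N a b := by
  unfold schemeVar; positivity

variable [CompleteSpace F] [SecondCountableTopology F] [IsGaussian μ]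

lemma IsSource.integral_schemeU1_sq (h : IsSource μ Q N x w t z) :
    ∫ ω, schemeU1 a b x w ω ^ 2 ∂μ = a ^ 2 * Q + b ^ 2 := by
  rw [integral_sq_eq_covarianceBilinDual_self _ h.centered]
  have e : schemeU1 a b x w = a • x + b • w + (0 : ℝ) • t + (0 : ℝ) • z := by
    unfold schemeU1; module
  rw [e, h.covarianceBilinDual_eq]; ring

lemma IsSource.integral_error_sq (h : IsSource μ Q N x w t z) (hQ : 0 < Q) (hN : 0 < N) :
    ∫ ω, ((x + schemeU1 a b x w) ω - schemeU2 Q N a b x w t z ω) ^ 2 ∂μ =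
      N * ((1 + a) ^ 2 * Q) / schemeVar Q N a b := by
  have hD := schemeVar_pos (a := a) (b := b) hQ hN
  have h1 := integral_sq_eq_covarianceBilinDual_self (μ := μ)
    (x + schemeU1 a b x w - schemeU2 Q N a b x w t z) h.centered
  simp only [sub_apply (x + schemeU1 a b x w)] at h1
  rw [h1]
  have e : x + schemeU1 a b x w - schemeU2 Q N a b x w t z =
      ((1 + a) * N / schemeVar Q N a b) • x + (0 : ℝ) • w +
      (-((1 + a) * b / schemeVar Q N a b)) • t +
      (-((1 + a) ^ 2 * Q / schemeVar Q N a b)) • z := by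
    -- The x-coefficient of the error; after division by 1 + a it is the identity D − b² − (1+a)²Q =
    -- N for the output variance D.
    have h2 : (1 + a) * N / schemeVar Q N a b = (1 + a) - (1 + a) * b / schemeVar Q N a b * b -
        (1 + a) ^ 2 * Q / schemeVar Q N a b * (1 + a) := by
      field_simp; unfold schemeVar; ring
    rw [h2]
    unfold schemeU2 schemeY schemeU1 schemeW2; module
  rw [e, h.covarianceBilinDual_eq]
  field_simp
  unfold schemeVar; ring

/-- Noise of variance NQ in W₂ makes the constraint tight: with D the output variance, Var(X₀ | W₁,
W₂) = NQ/(b²+N) and Var(Y₁ | W₁, W₂) = ND/(b²+N), so both ratios equal (b²+N)/N. -/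
lemma IsSource.condMutualInfo_le_mutualInfo_pair (h : IsSource μ Q N x w t z) (hQ : 0 < Q)
    (hN : 0 < N) :
    condMutualInfo μ (schemeW2 b x t) x w ≤
      mutualInfo μ (fun ω => (w ω, schemeW2 b x t ω)) (schemeY a b x w z) := by
  have hD := schemeVar_pos (a := a) (b := b) hQ hN
  have hb : 0 < b ^ 2 + N := by positivity
  have ew : w = (0 : ℝ) • x + (1 : ℝ) • w + (0 : ℝ) • t + (0 : ℝ) • z := by module
  have eW : schemeW2 b x t = b • x + (0 : ℝ) • w + (1 : ℝ) • t + (0 : ℝ) • z := by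
    unfold schemeW2; module
  have eY : schemeY a b x w z = (1 + a) • x + b • w + (0 : ℝ) • t + (1 : ℝ) • z := by
    unfold schemeY schemeU1; module
  obtain ⟨c, hc⟩ : ∃ c : ℝ, c = b / (b ^ 2 + N) := ⟨_, rfl⟩
  obtain ⟨R, hR⟩ : ∃ R : F →L[ℝ] ℝ,
      R = (1 - c * b) • x + (0 : ℝ) • w + (-c) • t + (0 : ℝ) • z := ⟨_, rfl⟩
  obtain ⟨T, hT⟩ : ∃ T : F →L[ℝ] ℝ, T = ((1 + a) * (1 - c * b)) • x + (0 : ℝ) • w +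
      (-((1 + a) * c)) • t + (1 : ℝ) • z := ⟨_, rfl⟩
  have hRR : covarianceBilinDual μ R R = N * Q / (b ^ 2 + N) := by
    rw [h.covarianceBilinDual_of_eq hR hR, hc]; field_simp; ring
  have hTT : covarianceBilinDual μ T T = N * schemeVar Q N a b / (b ^ 2 + N) := by
    rw [h.covarianceBilinDual_of_eq hT hT, hc]; unfold schemeVar; field_simp; ring
  have hYY : covarianceBilinDual μ (schemeY a b x w z) (schemeY a b x w z) =
      schemeVar Q N a b := by
    rw [h.covarianceBilinDual_of_eq eY eY]; unfold schemeVar; ring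
  rw [condMutualInfo_real (schemeW2 b x t) x w R x 0 c 0
      (by rw [hR]; unfold schemeW2; module) (by module)
      (by rw [h.covarianceBilinDual_of_eq hR ew]; ring)
      (by rw [h.covarianceBilinDual_of_eq hR eW, hc]; field_simp; ring) h.xw
      (by rw [h.xx]; exact hQ),
    mutualInfo_pair w (schemeW2 b x t) (schemeY a b x w z) T b ((1 + a) * c)
      (by rw [hT]; unfold schemeW2 schemeY schemeU1; module)
      (by rw [h.covarianceBilinDual_of_eq hT ew]; ring)
      (by rw [h.covarianceBilinDual_of_eq hT eW, hc]; field_simp; ring)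
      (by rw [hTT]; positivity) (by rw [hYY]; exact hD), hRR, hTT, hYY, h.xx,
    if_neg (by positivity)]
  refine le_of_eq ?_
  congr 3
  field_simp

/-- For 1 + a ≠ 0 the constraint is again tight: the residual of X₀ given (W₁, Y₁, U₂) has variance
QN/D, and both ratios equal D/((1+a)²Q + N). -/
lemma IsSource.condMutualInfo_le_mutualInfo (h : IsSource μ Q N x w t z) (hQ : 0 < Q)
    (hN : 0 < N) :
    condMutualInfo μ (schemeU2 Q N a b x w t z) x (fun ω => (w ω, schemeY a b x w z ω)) ≤
      mutualInfo μ w (schemeY a b x w z) := by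
  have hD := schemeVar_pos (a := a) (b := b) hQ hN
  have hA : 0 < (1 + a) ^ 2 * Q + N := by positivity
  have ew : w = (0 : ℝ) • x + (1 : ℝ) • w + (0 : ℝ) • t + (0 : ℝ) • z := by module
  have eY : schemeY a b x w z = (1 + a) • x + b • w + (0 : ℝ) • t + (1 : ℝ) • z := by
    unfold schemeY schemeU1; module
  have eU : schemeU2 Q N a b x w t z = ((1 + a) * (1 - N / schemeVar Q N a b)) • x + b • w +
      ((1 + a) * b / schemeVar Q N a b) • t + ((1 + a) ^ 2 * Q / schemeVar Q N a b) • z := by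
    have h2 : (1 + a) * (1 - N / schemeVar Q N a b) = (1 + a) * b / schemeVar Q N a b * b +
        (1 + a) ^ 2 * Q / schemeVar Q N a b * (1 + a) := by
      field_simp; unfold schemeVar; ring
    rw [h2]
    unfold schemeU2 schemeY schemeU1 schemeW2; module
  obtain ⟨β, hβ⟩ : ∃ β : ℝ, β = (1 + a) * Q / ((1 + a) ^ 2 * Q + N) := ⟨_, rfl⟩
  obtain ⟨S, hS⟩ : ∃ S : F →L[ℝ] ℝ,
      S = (1 - β * (1 + a)) • x + (0 : ℝ) • w + (0 : ℝ) • t + (-β) • z := ⟨_, rfl⟩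
  obtain ⟨T, hT⟩ : ∃ T : F →L[ℝ] ℝ,
      T = (1 + a) • x + (0 : ℝ) • w + (0 : ℝ) • t + (1 : ℝ) • z := ⟨_, rfl⟩
  obtain ⟨R, hR⟩ : ∃ R : F →L[ℝ] ℝ,
      R = (N / schemeVar Q N a b) • x + (0 : ℝ) • w + (-(b / schemeVar Q N a b)) • t +
        (-((1 + a) * Q / schemeVar Q N a b)) • z := ⟨_, rfl⟩
  have hSS : covarianceBilinDual μ S S = Q * N / ((1 + a) ^ 2 * Q + N) := by
    rw [h.covarianceBilinDual_of_eq hS hS, hβ]; field_simp; ring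
  have hTT : covarianceBilinDual μ T T = (1 + a) ^ 2 * Q + N := by
    rw [h.covarianceBilinDual_of_eq hT hT]; ring
  have hRR : covarianceBilinDual μ R R = Q * N / schemeVar Q N a b := by
    rw [h.covarianceBilinDual_of_eq hR hR]; field_simp; unfold schemeVar; ring
  have hYY : covarianceBilinDual μ (schemeY a b x w z) (schemeY a b x w z) =
      schemeVar Q N a b := by
    rw [h.covarianceBilinDual_of_eq eY eY]; unfold schemeVar; ring
  have hSw : covarianceBilinDual μ S w = 0 := by
    rw [h.covarianceBilinDual_of_eq hS ew]; ring
  have hSy : covarianceBilinDual μ S (schemeY a b x w z) = 0 := by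
    rw [h.covarianceBilinDual_of_eq hS eY, hβ]; field_simp; ring
  have hSpos : 0 < covarianceBilinDual μ S S := by rw [hSS]; positivity
  have hSx : x = S + (-(β * b)) • w + β • schemeY a b x w z := by
    rw [hS]; unfold schemeY schemeU1; module
  -- If the state is fully cancelled, U₂ = b W₁ carries no information about X₀ beyond W₁, and the
  -- left side is zero.
  by_cases ha : 1 + a = 0
  · have hβ0 : β = 0 := by rw [hβ, ha]; simp
    rw [condMutualInfo_pair (schemeU2 Q N a b x w t z) x w (schemeY a b x w z) S S
      (-(β * b)) β 0 (-(β * b)) β (by rw [zero_smul, add_zero]; exact hSx) hSx hSw hSy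
      (by rw [h.covarianceBilinDual_of_eq hS eU, hβ0, ha]; ring) hSw hSy hSpos,
      if_neg hSpos.ne', div_self hSpos.ne']
    simp
  -- Here R = (X₁ − U₂)/(1+a). Since U₂ is the best estimate of X₁, Y₁ enters the regression with
  -- coefficient 0.
  · rw [condMutualInfo_pair (schemeU2 Q N a b x w t z) x w (schemeY a b x w z) R S
      (-(b / (1 + a))) 0 (1 / (1 + a)) (-(β * b)) β
      (by
        rw [hR, eU]
        have h1 : (1 : ℝ) = N / schemeVar Q N a b +
          1 / (1 + a) * ((1 + a) * (1 - N / schemeVar Q N a b)) := by field_simp; ring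
        have h2 : b / schemeVar Q N a b = 1 / (1 + a) * ((1 + a) * b / schemeVar Q N a b) := by
          field_simp
        have h3 : (1 + a) * Q / schemeVar Q N a b =
            1 / (1 + a) * ((1 + a) ^ 2 * Q / schemeVar Q N a b) := by field_simp
        have h4 : b / (1 + a) = 1 / (1 + a) * b := by ring
        rw [h2, h3, h4]
        conv_lhs => rw [← one_smul ℝ x, h1]
        module)
      hSx (by rw [h.covarianceBilinDual_of_eq hR ew]; ring)
      (by rw [h.covarianceBilinDual_of_eq hR eY]; field_simp; ring)
      (by
        rw [h.covarianceBilinDual_of_eq hR eU]; field_simp; unfold schemeVar; ring)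
      hSw hSy hSpos,
      mutualInfo_real w (schemeY a b x w z) T b (by rw [hT]; unfold schemeY schemeU1; module)
      (by rw [h.covarianceBilinDual_of_eq hT ew]; ring) (by rw [hTT]; exact hA)
      (by rw [hYY]; exact hD), hRR, hSS, hTT, hYY, if_neg (by positivity)]
    refine le_of_eq ?_
    congr 3
    field_simp

end Achievability

/-! ### Information and kernels under change of sample space. -/

section Map

variable {Ω Ω' α β γ : Type*} [MeasurableSpace Ω] [MeasurableSpace Ω'] [MeasurableSpace α]
  [MeasurableSpace β] [MeasurableSpace γ]

lemma mutualInfo_map (μ : Measure Ω) {φ : Ω → Ω'} (hφ : Measurable φ) {X : Ω' → α} {Y : Ω' → β}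
    (hX : Measurable X) (hY : Measurable Y) :
    mutualInfo (μ.map φ) X Y = mutualInfo μ (fun ω => X (φ ω)) (fun ω => Y (φ ω)) := by
  unfold mutualInfo
  rw [Measure.map_map (by fun_prop) hφ, Measure.map_map hX hφ, Measure.map_map hY hφ]
  rfl

lemma condMutualInfo_map [StandardBorelSpace α] [Nonempty α] [StandardBorelSpace β] [Nonempty β]
    (μ : Measure Ω) [IsFiniteMeasure μ] {φ : Ω → Ω'} (hφ : Measurable φ) {X : Ω' → α} {Y : Ω' → β}
    {Z : Ω' → γ} (hX : Measurable X) (hY : Measurable Y) (hZ : Measurable Z) :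
    condMutualInfo (μ.map φ) X Y Z =
      condMutualInfo μ (fun ω => X (φ ω)) (fun ω => Y (φ ω)) (fun ω => Z (φ ω)) := by
  have h1 : condDistrib X Z (μ.map φ) = condDistrib (fun ω => X (φ ω)) (fun ω => Z (φ ω)) μ := by
    simp only [condDistrib]
    congr 1
    exact Measure.map_map (by fun_prop) hφ
  have h2 : condDistrib Y Z (μ.map φ) = condDistrib (fun ω => Y (φ ω)) (fun ω => Z (φ ω)) μ := by
    simp only [condDistrib]
    congr 1
    exact Measure.map_map (by fun_prop) hφ
  unfold condMutualInfo
  rw [h1, h2, Measure.map_map (by fun_prop) hφ, Measure.map_map hZ hφ]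
  rfl

lemma map_prod_left (μ : Measure Ω) (ν : Measure α) [SFinite μ] [SFinite ν] {φ : Ω → Ω'}
    (hφ : Measurable φ) :
    (μ.map φ).prod ν = (μ.prod ν).map (fun p => (φ p.1, p.2)) := by
  have := Measure.map_prod_map μ ν hφ measurable_id
  rwa [Measure.map_id] at this

/-- A kernel that applies a function to its input and an independent noise. -/
lemma compProd_noise (ρ : Measure α) [IsProbabilityMeasure ρ] (ν : Measure γ)
    [IsProbabilityMeasure ν] {f : α × γ → β} (hf : Measurable f) :
    ρ.compProd ((Kernel.id.prod (Kernel.const α ν)).map f) =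
      (ρ.prod ν).map (fun p => (p.1, f p)) := by
  refine Measure.ext_of_lintegral _ fun g hg => ?_
  rw [lintegral_map hg (by fun_prop), Measure.lintegral_compProd hg,
    lintegral_prod _ (by fun_prop)]
  refine lintegral_congr fun a => ?_
  rw [Kernel.map_apply _ hf, lintegral_map (by fun_prop) hf, Kernel.prod_apply, Kernel.id_apply,
    Kernel.const_apply, lintegral_prod _ (by fun_prop), lintegral_dirac' _ (by fun_prop)]

end Map

/-! ### The Gaussian source driving the scheme. -/

/-- Four independent centered Gaussian variables. -/
noncomputable def sourceLaw (v₀ v₁ v₂ v₃ : ℝ≥0) : Measure (((ℝ × ℝ) × ℝ) × ℝ) :=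
  (((gaussianReal 0 v₀).prod (gaussianReal 0 v₁)).prod (gaussianReal 0 v₂)).prod
    (gaussianReal 0 v₃)

instance (v₀ v₁ v₂ v₃ : ℝ≥0) : IsGaussian (sourceLaw v₀ v₁ v₂ v₃) := by
  unfold sourceLaw; infer_instance

namespace Source

/-- The first coordinate of the source. -/
def c₀ : ((ℝ × ℝ) × ℝ) × ℝ →L[ℝ] ℝ := (ContinuousLinearMap.fst ℝ ℝ ℝ).comp
  ((ContinuousLinearMap.fst ℝ (ℝ × ℝ) ℝ).comp (ContinuousLinearMap.fst ℝ ((ℝ × ℝ) × ℝ) ℝ))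

/-- The second coordinate of the source. -/
def c₁ : ((ℝ × ℝ) × ℝ) × ℝ →L[ℝ] ℝ := (ContinuousLinearMap.snd ℝ ℝ ℝ).comp
  ((ContinuousLinearMap.fst ℝ (ℝ × ℝ) ℝ).comp (ContinuousLinearMap.fst ℝ ((ℝ × ℝ) × ℝ) ℝ))

/-- The third coordinate of the source. -/
def c₂ : ((ℝ × ℝ) × ℝ) × ℝ →L[ℝ] ℝ :=
  (ContinuousLinearMap.snd ℝ (ℝ × ℝ) ℝ).comp (ContinuousLinearMap.fst ℝ ((ℝ × ℝ) × ℝ) ℝ)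

/-- The fourth coordinate of the source. -/
def c₃ : ((ℝ × ℝ) × ℝ) × ℝ →L[ℝ] ℝ := ContinuousLinearMap.snd ℝ ((ℝ × ℝ) × ℝ) ℝ

variable {v₀ v₁ v₂ v₃ : ℝ≥0}

lemma map_c₀ : (sourceLaw v₀ v₁ v₂ v₃).map c₀ = gaussianReal 0 v₀ := by
  have : ⇑c₀ = Prod.fst ∘ Prod.fst ∘ Prod.fst := rfl
  rw [this, ← Measure.map_map (by fun_prop) (by fun_prop),
    ← Measure.map_map (by fun_prop) (by fun_prop), sourceLaw]
  simp [Measure.map_fst_prod]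

lemma map_c₁ : (sourceLaw v₀ v₁ v₂ v₃).map c₁ = gaussianReal 0 v₁ := by
  have : ⇑c₁ = Prod.snd ∘ Prod.fst ∘ Prod.fst := rfl
  rw [this, ← Measure.map_map (by fun_prop) (by fun_prop),
    ← Measure.map_map (by fun_prop) (by fun_prop), sourceLaw]
  simp [Measure.map_fst_prod, Measure.map_snd_prod]

lemma map_c₂ : (sourceLaw v₀ v₁ v₂ v₃).map c₂ = gaussianReal 0 v₂ := by
  have : ⇑c₂ = Prod.snd ∘ Prod.fst := rfl
  rw [this, ← Measure.map_map (by fun_prop) (by fun_prop), sourceLaw]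
  simp [Measure.map_fst_prod, Measure.map_snd_prod]

lemma map_c₃ : (sourceLaw v₀ v₁ v₂ v₃).map c₃ = gaussianReal 0 v₃ := by
  have : ⇑c₃ = Prod.snd := rfl
  rw [this, sourceLaw]
  simp [Measure.map_snd_prod]

lemma integral_eq_zero_of_map {L : ((ℝ × ℝ) × ℝ) × ℝ →L[ℝ] ℝ} {v : ℝ≥0}
    (h : (sourceLaw v₀ v₁ v₂ v₃).map L = gaussianReal 0 v) :
    L (∫ ω, ω ∂(sourceLaw v₀ v₁ v₂ v₃)) = 0 := by
  rw [← L.integral_comp_comm (φ := fun ω => ω) IsGaussian.integrable_id]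
  have h1 := integral_id_gaussianReal (μ := 0) (v := v)
  rw [← h, integral_map (by fun_prop) (by fun_prop)] at h1
  exact h1

lemma integral_sourceLaw : ∫ ω, ω ∂(sourceLaw v₀ v₁ v₂ v₃) = 0 :=
  Prod.ext (Prod.ext (Prod.ext (integral_eq_zero_of_map map_c₀) (integral_eq_zero_of_map map_c₁))
    (integral_eq_zero_of_map map_c₂)) (integral_eq_zero_of_map map_c₃)

lemma cov_c₃ {l : ((ℝ × ℝ) × ℝ) × ℝ →L[ℝ] ℝ} {f : (ℝ × ℝ) × ℝ → ℝ} (hf : Measurable f)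
    (hl : ⇑l = fun ω => f ω.1) : covarianceBilinDual (sourceLaw v₀ v₁ v₂ v₃) l c₃ = 0 := by
  refine covarianceBilinDual_eq_zero_of_indepFun ?_
  rw [hl]
  exact indepFun_prod (Y := id) hf measurable_id

lemma cov_c₂ {l : ((ℝ × ℝ) × ℝ) × ℝ →L[ℝ] ℝ} {f : ℝ × ℝ → ℝ} (hf : Measurable f)
    (hl : ⇑l = fun ω => f ω.1.1) : covarianceBilinDual (sourceLaw v₀ v₁ v₂ v₃) l c₂ = 0 := by
  refine covarianceBilinDual_eq_zero_of_indepFun ?_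
  rw [hl]
  refine (indepFun_map_iff_comp (φ := Prod.fst) (f := fun p : (ℝ × ℝ) × ℝ => f p.1)
    (g := Prod.snd) measurable_fst (by fun_prop) measurable_snd).1 ?_
  rw [sourceLaw, Measure.map_fst_prod, measure_univ, one_smul]
  exact indepFun_prod (Y := id) hf measurable_id

lemma cov_c₁ : covarianceBilinDual (sourceLaw v₀ v₁ v₂ v₃) c₀ c₁ = 0 := by
  refine covarianceBilinDual_eq_zero_of_indepFun ?_
  refine (indepFun_map_iff_comp (φ := fun p : ((ℝ × ℝ) × ℝ) × ℝ => p.1.1) (f := Prod.fst)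
    (g := Prod.snd) (by fun_prop) measurable_fst measurable_snd).1 ?_
  have : (fun p : ((ℝ × ℝ) × ℝ) × ℝ => p.1.1) = Prod.fst ∘ Prod.fst := rfl
  rw [this, ← Measure.map_map (by fun_prop) (by fun_prop), sourceLaw, Measure.map_fst_prod,
    measure_univ, one_smul, Measure.map_fst_prod, measure_univ, one_smul]
  exact indepFun_prod (X := id) (Y := id) measurable_id measurable_id

lemma isSource (Q N : ℝ≥0) : IsSource (sourceLaw Q 1 (N * Q) N) Q N c₀ c₁ c₂ c₃ where
  centered := integral_sourceLaw
  xx := covarianceBilinDual_self_of_map_eq map_c₀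
  ww := by rw [covarianceBilinDual_self_of_map_eq map_c₁]; simp
  tt := by rw [covarianceBilinDual_self_of_map_eq map_c₂]; simp
  zz := covarianceBilinDual_self_of_map_eq map_c₃
  xw := cov_c₁
  xt := cov_c₂ measurable_fst rfl
  xz := cov_c₃ (f := fun p => p.1.1) (by fun_prop) rfl
  wt := cov_c₂ measurable_snd rfl
  wz := cov_c₃ (f := fun p => p.1.2) (by fun_prop) rfl
  tz := cov_c₃ measurable_snd rfl

/-- In a direct design the noise of W₂ is drawn last, inside the kernel of U₂, so the last two
coordinates exchange roles. -/
lemma isSource_swap (Q N : ℝ≥0) : IsSource (sourceLaw Q 1 N (N * Q)) Q N c₀ c₁ c₃ c₂ where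
  centered := integral_sourceLaw
  xx := covarianceBilinDual_self_of_map_eq map_c₀
  ww := by rw [covarianceBilinDual_self_of_map_eq map_c₁]; simp
  tt := by rw [covarianceBilinDual_self_of_map_eq map_c₃]; simp
  zz := covarianceBilinDual_self_of_map_eq map_c₂
  xw := cov_c₁
  xt := cov_c₃ (f := fun p => p.1.1) (by fun_prop) rfl
  xz := cov_c₂ measurable_fst rfl
  wt := cov_c₃ (f := fun p => p.1.2) (by fun_prop) rfl
  wz := cov_c₂ measurable_snd rfl
  tz := by rw [covarianceBilinDual_comm]; exact cov_c₃ measurable_snd rfl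

end Source

/-! ### The linear scheme as kernels and as a linear image of the source. -/

open Source

/-- The second action of the linear scheme as a function of `(w₁, w₂, y₁)`. -/
noncomputable def schemeAction (Q N a b : ℝ) (p : ℝ × ℝ × ℝ) : ℝ :=
  b * p.1 + ((1 + a) * b / schemeVar Q N a b) * p.2.1 +
    ((1 + a) ^ 2 * Q / schemeVar Q N a b) * (p.2.2 - b * p.1)

@[fun_prop]
lemma measurable_schemeAction (Q N a b : ℝ) : Measurable (schemeAction Q N a b) := by
  unfold schemeAction; fun_prop

/-- The linear scheme as a design. -/
noncomputable def schemeDesign (Q N : ℝ≥0) (a b : ℝ) : Design :=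
  haveI : IsMarkovKernel ((Kernel.id.prod (Kernel.const (ℝ × ℝ) (gaussianReal 0 (N * Q)))).map
    fun p => b * p.1.1 + p.2) := Kernel.IsMarkovKernel.map _ (by fun_prop)
  { lawW1 := gaussianReal 0 1
    kerW2 := (Kernel.id.prod (Kernel.const (ℝ × ℝ) (gaussianReal 0 (N * Q)))).map
      fun p => b * p.1.1 + p.2
    kerU1 := Kernel.deterministic (fun p => a * p.1 + b * p.2) (by fun_prop)
    kerU2 := Kernel.deterministic (schemeAction Q N a b) (by fun_prop) }

/-- The linear scheme as a direct design. -/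
noncomputable def schemeDirectDesign (Q N : ℝ≥0) (a b : ℝ) : DirectDesign :=
  haveI : IsMarkovKernel ((Kernel.id.prod (Kernel.const (ℝ × ℝ × ℝ) (gaussianReal 0 (N * Q)))).map
    fun p => schemeAction Q N a b (p.1.2.1, b * p.1.1 + p.2, p.1.2.2)) :=
      Kernel.IsMarkovKernel.map _ (by fun_prop)
  { lawW1 := gaussianReal 0 1
    kerU1 := Kernel.deterministic (fun p => a * p.1 + b * p.2) (by fun_prop)
    kerU2 := (Kernel.id.prod (Kernel.const (ℝ × ℝ × ℝ) (gaussianReal 0 (N * Q)))).map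
      fun p => schemeAction Q N a b (p.1.2.1, b * p.1.1 + p.2, p.1.2.2) }

/-- The outcome of the linear scheme as a function of the source. -/
noncomputable def schemeOutcome (Q N a b : ℝ) : ((ℝ × ℝ) × ℝ) × ℝ →L[ℝ] Outcome :=
  (((c₀.prod c₁).prod ((schemeW2 b c₀ c₂).prod (schemeU1 a b c₀ c₁))).prod
    ((c₀ + schemeU1 a b c₀ c₁).prod (schemeY a b c₀ c₁ c₃))).prod (schemeU2 Q N a b c₀ c₁ c₂ c₃)

/-- The outcome of the linear scheme, as a direct design, as a function of the source. -/
noncomputable def schemeDirectOutcome (Q N a b : ℝ) :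
    ((ℝ × ℝ) × ℝ) × ℝ →L[ℝ] DirectDesign.Outcome :=
  (((c₀.prod c₁).prod (schemeU1 a b c₀ c₁)).prod
    ((c₀ + schemeU1 a b c₀ c₁).prod (schemeY a b c₀ c₁ c₂))).prod (schemeU2 Q N a b c₀ c₁ c₃ c₂)

lemma schemeDesign_law (Q N : ℝ≥0) (a b : ℝ) :
    (schemeDesign Q N a b).law Q N = (sourceLaw Q 1 (N * Q) N).map (schemeOutcome Q N a b) := by
  have h1 : (schemeDesign Q N a b).inputLaw Q =
      (((gaussianReal 0 Q).prod (gaussianReal 0 1)).prod (gaussianReal 0 (N * Q))).map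
        (fun p => (p.1, (b * p.1.1 + p.2, a * p.1.1 + b * p.1.2))) := by
    rw [← compProd_noise _ _ (f := fun p : (ℝ × ℝ) × ℝ =>
      (b * p.1.1 + p.2, a * p.1.1 + b * p.1.2)) (by fun_prop), Design.inputLaw]
    refine Measure.compProd_congr (Filter.Eventually.of_forall fun p => ?_)
    refine Measure.ext_of_lintegral _ fun g hg => ?_
    rw [Kernel.prod_apply, lintegral_prod _ (by fun_prop), schemeDesign,
      Kernel.map_apply _ (by fun_prop), Kernel.map_apply _ (by fun_prop),
      lintegral_map (by fun_prop) (by fun_prop), lintegral_map (by fun_prop) (by fun_prop),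
      Kernel.prod_apply, Kernel.id_apply, lintegral_prod _ (by fun_prop),
      lintegral_prod _ (by fun_prop), lintegral_dirac' _ (by fun_prop),
      lintegral_dirac' _ (by fun_prop)]
    refine lintegral_congr fun t => ?_
    rw [Kernel.deterministic_apply, lintegral_dirac' _ (by fun_prop)]
  have h2 : (schemeDesign Q N a b).outputLaw Q N = (sourceLaw Q 1 (N * Q) N).map
      (fun p => ((p.1.1, (b * p.1.1.1 + p.1.2, a * p.1.1.1 + b * p.1.1.2)),
        (p.1.1.1 + (a * p.1.1.1 + b * p.1.1.2),
          p.1.1.1 + (a * p.1.1.1 + b * p.1.1.2) + p.2))) := by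
    rw [Design.outputLaw, compProd_channel_comap, h1, map_prod_left _ _ (by fun_prop),
      Measure.map_map (by fun_prop) (by fun_prop), sourceLaw]
    rfl
  have h3 : (schemeDesign Q N a b).kerU2.comap (fun p : ((ℝ × ℝ) × (ℝ × ℝ)) × (ℝ × ℝ) =>
      (p.1.1.2, p.1.2.1, p.2.2)) (by fun_prop) = Kernel.deterministic
      (fun p => schemeAction Q N a b (p.1.1.2, p.1.2.1, p.2.2)) (by fun_prop) := by
    ext p : 1
    rw [Kernel.comap_apply, schemeDesign, Kernel.deterministic_apply, Kernel.deterministic_apply]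
  rw [Design.law_eq, h3, Measure.compProd_deterministic, h2,
    Measure.map_map (by fun_prop) (by fun_prop)]
  rfl

lemma schemeDirectDesign_law (Q N : ℝ≥0) (a b : ℝ) :
    (schemeDirectDesign Q N a b).law Q N =
      (sourceLaw Q 1 N (N * Q)).map (schemeDirectOutcome Q N a b) := by
  have h1 : (schemeDirectDesign Q N a b).inputLaw Q =
      ((gaussianReal 0 Q).prod (gaussianReal 0 1)).map
        (fun p => (p, a * p.1 + b * p.2)) := by
    rw [DirectDesign.inputLaw, schemeDirectDesign, Measure.compProd_deterministic]
  have h2 : (schemeDirectDesign Q N a b).outputLaw Q N =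
      (((gaussianReal 0 Q).prod (gaussianReal 0 1)).prod (gaussianReal 0 N)).map
      (fun p => ((p.1, a * p.1.1 + b * p.1.2), (p.1.1 + (a * p.1.1 + b * p.1.2),
          p.1.1 + (a * p.1.1 + b * p.1.2) + p.2))) := by
    rw [DirectDesign.outputLaw, compProd_channel_comap, h1, map_prod_left _ _ (by fun_prop),
      Measure.map_map (by fun_prop) (by fun_prop)]
    rfl
  -- The kernel for U₂ sees X₀, so it can generate W₂ = b X₀ + T itself with a fresh T.
  have h3 : (schemeDirectDesign Q N a b).kerU2.comap (fun p : ((ℝ × ℝ) × ℝ) × (ℝ × ℝ) =>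
      (p.1.1.1, p.1.1.2, p.2.2)) (by fun_prop) =
      (Kernel.id.prod (Kernel.const _ (gaussianReal 0 (N * Q)))).map
      (fun p : (((ℝ × ℝ) × ℝ) × (ℝ × ℝ)) × ℝ => schemeAction Q N a b
        (p.1.1.1.2, b * p.1.1.1.1 + p.2, p.1.2.2)) := by
    ext p : 1
    rw [Kernel.comap_apply, schemeDirectDesign, Kernel.map_apply _ (by fun_prop),
      Kernel.map_apply _ (by fun_prop)]
    refine Measure.ext_of_lintegral _ fun g hg => ?_
    rw [lintegral_map (by fun_prop) (by fun_prop), lintegral_map (by fun_prop) (by fun_prop),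
      Kernel.prod_apply, Kernel.prod_apply, Kernel.id_apply, Kernel.id_apply,
      lintegral_prod _ (by fun_prop), lintegral_prod _ (by fun_prop),
      lintegral_dirac' _ (by fun_prop), lintegral_dirac' _ (by fun_prop)]
    rfl
  rw [DirectDesign.law_eq, h3, compProd_noise _ _ (by fun_prop), h2,
    map_prod_left _ _ (by fun_prop), Measure.map_map (by fun_prop) (by fun_prop), sourceLaw]
  rfl

/-! ### Membership and cost of the scheme in the three problems. -/

section Domains

variable {Q N : ℝ≥0} {a b P : ℝ}

lemma isGaussian_schemeDesign_law : IsGaussian ((schemeDesign Q N a b).law Q N) := by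
  rw [schemeDesign_law]; infer_instance

lemma schemeDesign_power : ∫ ω, U1 ω ^ 2 ∂((schemeDesign Q N a b).law Q N) =
    a ^ 2 * Q + b ^ 2 := by
  rw [schemeDesign_law, integral_map (by fun_prop)
    (Measurable.aestronglyMeasurable (by unfold U1; fun_prop))]
  exact (isSource Q N).integral_schemeU1_sq

lemma schemeDesign_cost (hQ : 0 < Q) (hN : 0 < N) : (schemeDesign Q N a b).cost Q N =
    N * ((1 + a) ^ 2 * Q) / schemeVar Q N a b := by
  rw [Design.cost, schemeDesign_law, integral_map (by fun_prop)
    (Measurable.aestronglyMeasurable (by unfold X1 U2; fun_prop))]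
  exact (isSource Q N).integral_error_sq (by simpa using hQ) (by simpa using hN)

lemma schemeDesign_mem_domain (hQ : 0 < Q) (hN : 0 < N) (hP : a ^ 2 * Q + b ^ 2 = P) :
    schemeDesign Q N a b ∈ domain Q N P := by
  refine ⟨isGaussian_schemeDesign_law, by rw [schemeDesign_power, hP], ?_⟩
  simp only [schemeDesign_law]
  rw [condMutualInfo_map _ (by fun_prop) (by unfold W2; fun_prop) (by unfold X0; fun_prop)
    (by unfold W1; fun_prop), mutualInfo_map _ (by fun_prop) (by unfold W1 W2; fun_prop)
    (by unfold Y1; fun_prop)]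
  exact (isSource Q N).condMutualInfo_le_mutualInfo_pair (by simpa using hQ) (by simpa using hN)

lemma schemeDesign_mem_feedbackDomain (hQ : 0 < Q) (hN : 0 < N) (hP : a ^ 2 * Q + b ^ 2 = P) :
    schemeDesign Q N a b ∈ feedbackDomain Q N P := by
  refine ⟨isGaussian_schemeDesign_law, by rw [schemeDesign_power, hP], ?_⟩
  simp only [schemeDesign_law]
  rw [condMutualInfo_map _ (by fun_prop) (by unfold U2; fun_prop) (by unfold X0; fun_prop)
    (by unfold W1 Y1; fun_prop), mutualInfo_map _ (by fun_prop) (by unfold W1; fun_prop)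
    (by unfold Y1; fun_prop)]
  exact (isSource Q N).condMutualInfo_le_mutualInfo (by simpa using hQ) (by simpa using hN)

lemma schemeDirectDesign_cost (hQ : 0 < Q) (hN : 0 < N) : (schemeDirectDesign Q N a b).cost Q N =
    N * ((1 + a) ^ 2 * Q) / schemeVar Q N a b := by
  rw [DirectDesign.cost, schemeDirectDesign_law, integral_map (by fun_prop)
    (Measurable.aestronglyMeasurable (by unfold DirectDesign.X1 DirectDesign.U2; fun_prop))]
  exact (isSource_swap Q N).integral_error_sq (by simpa using hQ) (by simpa using hN)

lemma schemeDirectDesign_mem_domain (hQ : 0 < Q) (hN : 0 < N) (hP : a ^ 2 * Q + b ^ 2 = P) :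
    schemeDirectDesign Q N a b ∈ DirectDesign.domain Q N P := by
  refine ⟨?_, ?_, ?_⟩
  · rw [schemeDirectDesign_law]; infer_instance
  · rw [schemeDirectDesign_law, integral_map (by fun_prop)
      (Measurable.aestronglyMeasurable (by unfold DirectDesign.U1; fun_prop)), ← hP]
    exact (isSource_swap Q N).integral_schemeU1_sq
  simp only [schemeDirectDesign_law]
  rw [condMutualInfo_map _ (by fun_prop) (by unfold DirectDesign.U2; fun_prop)
    (by unfold DirectDesign.X0; fun_prop)
    (by unfold DirectDesign.W1 DirectDesign.Y1; fun_prop),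
    mutualInfo_map _ (by fun_prop) (by unfold DirectDesign.W1; fun_prop)
    (by unfold DirectDesign.Y1; fun_prop)]
  exact (isSource_swap Q N).condMutualInfo_le_mutualInfo (by simpa using hQ) (by simpa using hN)

end Domains

/-- Some linear scheme of power `P` achieves the closed formula. -/
lemma exists_scheme_cost_eq {Q N P : ℝ} (hQ : 0 < Q) (hN : 0 < N) (hP : 0 ≤ P) :
    ∃ a b : ℝ, a ^ 2 * Q + b ^ 2 = P ∧
      N * ((1 + a) ^ 2 * Q) / schemeVar Q N a b = optimalCost Q N P := by
  unfold optimalCost schemeVar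
  split_ifs with h
  · obtain ⟨h4, h1, h2⟩ := h
    have hdisc : 0 ≤ Q ^ 2 - 4 * Q * N := by nlinarith
    unfold powerOne at h1
    unfold powerTwo at h2
    -- P₁ and P₂ are the roots of (P+N)² = PQ, so lying between them is equivalent to (P+N)² ≤ PQ.
    have habs : (2 * P - (Q - 2 * N)) ^ 2 ≤ Q ^ 2 - 4 * Q * N := by
      rw [← Real.sq_sqrt hdisc]
      exact sq_le_sq' (by linarith) (by linarith)
    have hPN : (P + N) ^ 2 ≤ P * Q := by nlinarith
    have hb : 0 ≤ P - (P + N) ^ 2 / Q := by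
      rw [sub_nonneg, div_le_iff₀ hQ]; exact hPN
    -- The equality case of the one-parameter bound: |a|√Q = s = (P+N)/√Q, and the remaining power P
    -- − s² goes to W₁.
    refine ⟨-(P + N) / Q, √(P - (P + N) ^ 2 / Q), ?_, ?_⟩
    · rw [Real.sq_sqrt hb]; field_simp; ring
    · rw [Real.sq_sqrt hb]
      have e : N + (P - (P + N) ^ 2 / Q) + (1 + -(P + N) / Q) ^ 2 * Q = Q - N - P := by
        field_simp; ring
      have hK : 0 < Q - N - P := by
        rw [← e]; positivity
      rw [e, div_eq_div_iff hK.ne' hQ.ne']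
      field_simp
      ring
  · unfold linearCost
    split_ifs with hPQ
    · have hq : 0 < √Q := Real.sqrt_pos.2 hQ
      have hq2 : √Q ^ 2 = Q := Real.sq_sqrt hQ.le
      have hp2 : √P ^ 2 = P := Real.sq_sqrt hP
      have e : (1 + -(√P / √Q)) ^ 2 * Q = (√Q - √P) ^ 2 := by
        rw [show 1 + -(√P / √Q) = (√Q - √P) / √Q by field_simp; ring, div_pow, hq2]
        field_simp
      -- All the power shrinks the state.
      refine ⟨-(√P / √Q), 0, ?_, ?_⟩
      · rw [neg_sq, div_pow, hp2, hq2]; field_simp; ring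
      · rw [e]
        congr 1 <;> ring
    · push Not at hPQ
      -- The state is cancelled and the excess power is spent on W₁, which the decoder knows.
      refine ⟨-1, √(P - Q), ?_, ?_⟩
      · rw [Real.sq_sqrt (by linarith)]; ring
      · simp

end Witsenhausen

/-! ### The main theorem. -/

theorem mainTheorem3 (Q N : ℝ≥0) (hQ : 0 < Q) (hN : 0 < N) (P : ℝ) (hP : 0 ≤ P) :
    -- the problem with channel feedback
    ((Witsenhausen.feedbackDomain Q N P).Nonempty ∧
      Witsenhausen.feedbackGaussianCost Q N P = Witsenhausen.optimalCost Q N P) ∧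
    -- the same, with the second action generated directly from the state, `W₁` and `Y₁`
    ((Witsenhausen.DirectDesign.domain Q N P).Nonempty ∧
      Witsenhausen.directFeedbackGaussianCost Q N P = Witsenhausen.optimalCost Q N P) ∧
    -- feedback gives no gain over the problem without feedback
    ((Witsenhausen.domain Q N P).Nonempty ∧
      Witsenhausen.gaussianCost Q N P = Witsenhausen.optimalCost Q N P ∧
      Witsenhausen.feedbackGaussianCost Q N P = Witsenhausen.gaussianCost Q N P ∧
      Witsenhausen.directFeedbackGaussianCost Q N P = Witsenhausen.gaussianCost Q N P) := by
  -- One pair (a, b) serves all three problems, so each infimum is an attained minimum.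
  obtain ⟨a, b, hab, hcost⟩ := Witsenhausen.exists_scheme_cost_eq (Q := Q) (N := N)
    (by simpa using hQ) (by simpa using hN) hP
  have hfb : Witsenhausen.feedbackGaussianCost Q N P = Witsenhausen.optimalCost Q N P :=
    IsLeast.csInf_eq ⟨⟨_, Witsenhausen.schemeDesign_mem_feedbackDomain hQ hN hab,
      (Witsenhausen.schemeDesign_cost hQ hN).trans hcost⟩,
      Set.forall_mem_image.2 fun _ =>
        Witsenhausen.Design.optimalCost_le_cost_of_mem_feedbackDomain hQ hN⟩
  have hdir : Witsenhausen.directFeedbackGaussianCost Q N P = Witsenhausen.optimalCost Q N P :=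
    IsLeast.csInf_eq ⟨⟨_, Witsenhausen.schemeDirectDesign_mem_domain hQ hN hab,
      (Witsenhausen.schemeDirectDesign_cost hQ hN).trans hcost⟩,
      Set.forall_mem_image.2 fun _ =>
        Witsenhausen.DirectDesign.optimalCost_le_cost_of_mem_domain hQ hN⟩
  have hg : Witsenhausen.gaussianCost Q N P = Witsenhausen.optimalCost Q N P :=
    IsLeast.csInf_eq ⟨⟨_, Witsenhausen.schemeDesign_mem_domain hQ hN hab,
      (Witsenhausen.schemeDesign_cost hQ hN).trans hcost⟩,
      Set.forall_mem_image.2 fun _ =>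
        Witsenhausen.Design.optimalCost_le_cost_of_mem_domain hQ hN⟩
  exact ⟨⟨⟨_, Witsenhausen.schemeDesign_mem_feedbackDomain hQ hN hab⟩, hfb⟩,
    ⟨⟨_, Witsenhausen.schemeDirectDesign_mem_domain hQ hN hab⟩, hdir⟩,
    ⟨_, Witsenhausen.schemeDesign_mem_domain hQ hN hab⟩, hg, hfb.trans hg.symm,
    hdir.trans hg.symm⟩
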